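/- Let $X$ be an infinite-dimensional separable Banach space over $\mathbb{K}=\mathbb{R}$ or $\mathbb{C}$, and let $\mathcal{L}(X)$ be the set of bounded linear operators from $X$ to $X$. The strong operator topology on $\mathcal{L}(X)$ is the topology in which every $T\in\mathcal{L}(X)$ has a neighbourhood basis consisting of the sets $\{S\in\mathcal{L}(X):\|Sx_i-Tx_i\|<\varepsilon,\ i=1,\dots,n\}$ with $x_1,\dots,x_n\in X$ and $\varepsilon>0$. An operator $T\in\mathcal{L}(X)$ is hypercyclic if there is $x\in X$ whose orbit $\{T^nx:n\ge 0\}$ is dense in $X$. A vector $x\in X$ is absolutely mean irregular for $T$ if $$\liminf_{n\to\infty}\frac1n\sum_{i=1}^n\|T^ix\|=0\quad\text{and}\quad\limsup_{n\to\infty}\frac1n\sum_{i=1}^n\|T^ix\|=\infty .$$ An absolutely mean irregular manifold for $T$ is a vector subspace $Y$ of $X$ such that every non-zero vector in $Y$ is absolutely mean irregular for $T$. Then: 1. the collection of hypercyclic operators $T\in\mathcal{L}(X)$ for which there is a residual set of absolutely mean irregular vectors is dense in $\mathcal{L}(X)$ with respect to the strong operator topology; 2. the collection of hypercyclic operators $T\in\mathcal{L}(X)$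 admitting a dense absolutely mean irregular manifold is dense in $\mathcal{L}(X)$ with respect to the strong operator topology. -/

import Mathlib

open Filter Topology

noncomputable section

variable {𝕜 X : Type*} [RCLike 𝕜] [NormedAddCommGroup X] [NormedSpace 𝕜 X]

/-- `x` is a hypercyclic vector of `T`: its orbit `{T ^ n x : n ≥ 0}` is dense in `X`. -/
def IsHypercyclicVector (T : X →L[𝕜] X) (x : X) : Prop :=
  Dense (Set.range fun n : ℕ => (T ^ n) x)

/-- `T` is hypercyclic: it has a hypercyclic vector. -/
def IsHypercyclic (T : X →L[𝕜] X) : Prop :=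
  ∃ x : X, IsHypercyclicVector T x

/-- The mean `(1 / n) * ∑_{i = 1}^{n} ‖T ^ i x‖`; only large `n` matter below. -/
def orbitMean (T : X →L[𝕜] X) (x : X) (n : ℕ) : ℝ :=
  (1 / (n : ℝ)) * ∑ i ∈ Finset.Icc 1 n, ‖(T ^ i) x‖

/-- `x` is absolutely mean irregular for `T`: the means of the norms along its orbit have
lower limit `0` and upper limit `∞`. Both limits are taken in the extended reals. -/
def IsAbsolutelyMeanIrregular (T : X →L[𝕜] X) (x : X) : Prop :=
  liminf (fun n : ℕ => (orbitMean T x n : EReal)) atTop = 0 ∧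
    limsup (fun n : ℕ => (orbitMean T x n : EReal)) atTop = ⊤

/-- The vector subspace `Y` is an absolutely mean irregular manifold for `T`: all of its non-zero
vectors are absolutely mean irregular. -/
def IsAbsolutelyMeanIrregularManifold (T : X →L[𝕜] X) (Y : Submodule 𝕜 X) : Prop :=
  ∀ y ∈ Y, y ≠ 0 → IsAbsolutelyMeanIrregular T y

/-- `T` has a residual (comeagre) set of absolutely mean irregular vectors. -/
def HasResidualAbsolutelyMeanIrregular (T : X →L[𝕜] X) : Prop :=
  ∃ X₀ : Set X, X₀ ∈ residual X ∧ ∀ x ∈ X₀, IsAbsolutelyMeanIrregular T x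

/-- `T` admits a dense absolutely mean irregular manifold. -/
def HasDenseAbsolutelyMeanIrregularManifold (T : X →L[𝕜] X) : Prop :=
  ∃ Y : Submodule 𝕜 X, Dense (Y : Set X) ∧ IsAbsolutelyMeanIrregularManifold T Y

/-- The set `𝒜` of bounded operators is dense in the space of all bounded operators on `X` for the
strong operator topology, which is the topology of `X →Lₚₜ[𝕜] X`. -/
def IsSOTDense (𝒜 : Set (X →L[𝕜] X)) : Prop :=
  Dense (ContinuousLinearMap.toPointwiseConvergenceCLM 𝕜 (RingHom.id 𝕜) X X '' 𝒜)

end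

/-! The operators found are `T = exp K` with `K` a norm limit of finite rank nilpotent operators.
Finite rank operators `N` with `N ^ 2 = 0` approximate any bounded operator strongly, and `exp N = 1
+ N`. As `exp` is norm continuous, it suffices to find good `K` norm-close to each finite rank
nilpotent `N`. This is a Baire category argument in (closure of the finite rank nilpotents) × `X`:
the requirements of `IsIrregularPair` are countably many open conditions, so only the density of
each has to be shown.

A generic pair `(K, x)` gives everything. `K` is quasinilpotent, so a nonzero polynomial in `K` is
`K ^ k r(K)` with `r(K)` invertible. All these operators commute with `T`, so small means pass from
`x` to `q(K) x`, and large means pass from `K ^ k x` to `q(K) x` through `r(K)⁻¹`. The manifold of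
all `q(K) x` is dense because its closure contains the `T`-orbit of `x`. A dense manifold yields a
residual set, since irregularity is a Gδ condition.

Density rests on finding `K` near `N` and `y` near `x` with `T ^ n y` small for `n` in a long range.
Put `x` at position `d` of a long Jordan chain `f` of `K`. On `y = ∑ β j • f j` the operator `T ^ n`
produces the coefficients `∑ k, n ^ k / k! * β (i + k)`. For `β j = (-c) ^ j / (j + 1)!` these are
Bessel–Clifford functions of `c n`, up to a factor; they are bounded and tend to `0`. Combining
several `c` gives `β j = 0` for `j < d`, `β d = 1` and a tiny tail (`exists_decaying_coefficients`).

This needs `∑ b ^ j / (j + 1)! * ‖f j‖` to be controlled independently of the length of the chain.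
Prolonging a chain with steps `w i` makes its norms grow like `∏ (w i)⁻¹`, so `w` must decay more
slowly than `1 / i`. A Dvoretzky–Rogers system, with an upper ℓ² estimate, makes the perturbation
small as soon as `∑ w i ^ 2` is. The choice `w i ~ i ^ (-3 / 4)` meets both demands
(`exists_chain_perturbation`). -/

noncomputable section

/-! ### Bessel–Clifford functions: bounds and decay on the half-line -/

/-- The entire function `∑ (-t) ^ k / (k! (k + ν)!)`, that is `t ^ (-ν / 2) J_ν (2 √t)`. -/
def besselClifford (ν : ℕ) (t : ℝ) : ℝ :=
  ∑' k : ℕ, (-t) ^ k / (k.factorial * (k + ν).factorial)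

lemma besselClifford_term_bound (ν k : ℕ) {t r : ℝ} (h : |t| ≤ r) :
    |(-t) ^ k / ((k.factorial : ℝ) * (k + ν).factorial)| ≤ r ^ k / k.factorial := by
  have h1 : (1 : ℝ) ≤ (k + ν).factorial := by exact_mod_cast Nat.factorial_pos _
  have h2 : (0 : ℝ) < k.factorial := by exact_mod_cast Nat.factorial_pos _
  rw [abs_div, abs_pow, abs_neg, abs_of_pos (by positivity : (0 : ℝ) < k.factorial * (k + ν).factorial)]
  have : |t| ^ k ≤ r ^ k := by gcongr
  apply div_le_div₀ (le_trans (by positivity) this) this h2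
  nlinarith

lemma summable_besselClifford (ν : ℕ) (t : ℝ) :
    Summable fun k : ℕ => (-t) ^ k / ((k.factorial : ℝ) * (k + ν).factorial) :=
  Summable.of_norm_bounded (Real.summable_pow_div_factorial |t|)
    fun k => besselClifford_term_bound ν k le_rfl

lemma besselClifford_zero (ν : ℕ) : besselClifford ν 0 = 1 / ν.factorial := by
  rw [besselClifford, tsum_eq_single 0]
  · simp
  · intro k hk; simp [hk]

lemma hasDerivAt_besselClifford (ν : ℕ) (t : ℝ) :
    HasDerivAt (besselClifford ν) (-besselClifford (ν + 1) t) t := by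
  have hterm (k : ℕ) (y : ℝ) : HasDerivAt
      (fun y : ℝ => (-y) ^ (k + 1) / (((k + 1).factorial : ℝ) * (k + 1 + ν).factorial))
      (-((-y) ^ k / ((k.factorial : ℝ) * (k + (ν + 1)).factorial))) y := by
    have h := (((hasDerivAt_id y).neg).pow (k + 1)).div_const
      (((k + 1).factorial : ℝ) * (k + 1 + ν).factorial)
    convert! h using 1
    have e : k + (ν + 1) = k + 1 + ν := by ring
    rw [e, Nat.factorial_succ k]
    have h2 : (k.factorial : ℝ) ≠ 0 := by exact_mod_cast (Nat.factorial_pos _).ne'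
    have h3 : ((k + 1 + ν).factorial : ℝ) ≠ 0 := by exact_mod_cast (Nat.factorial_pos _).ne'
    have h4 : (k + 1 : ℝ) ≠ 0 := by positivity
    push_cast
    simp only [Pi.neg_apply, id]
    field_simp
  have key := hasDerivAt_tsum_of_isPreconnected
    (g := fun (k : ℕ) (y : ℝ) => (-y) ^ (k + 1) / (((k + 1).factorial : ℝ) * (k + 1 + ν).factorial))
    (g' := fun k y => -((-y) ^ k / ((k.factorial : ℝ) * (k + (ν + 1)).factorial)))
    (t := Metric.ball 0 (|t| + 1)) (y₀ := t) (y := t)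
    (Real.summable_pow_div_factorial (|t| + 1)) Metric.isOpen_ball
    (convex_ball _ _).isPreconnected (fun k y _ => hterm k y)
    (fun k y hy => by
      rw [norm_neg]
      refine besselClifford_term_bound _ k ?_
      simpa using (Metric.mem_ball.1 hy).le)
    (by simp) ((summable_nat_add_iff 1).2 (summable_besselClifford ν t)) (by simp)
  rw [tsum_neg] at key
  have e : besselClifford ν = fun y => 1 / (ν.factorial : ℝ) + ∑' k : ℕ,
      (-y) ^ (k + 1) / (((k + 1).factorial : ℝ) * (k + 1 + ν).factorial) := by
    ext y
    rw [besselClifford, (summable_besselClifford ν y).tsum_eq_zero_add]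
    simp
  rw [e]
  exact key.const_add _

lemma besselClifford_recurrence (ν : ℕ) (t : ℝ) :
    besselClifford ν t = (ν + 1) * besselClifford (ν + 1) t - t * besselClifford (ν + 2) t := by
  have hs := summable_besselClifford (ν + 2) t
  have e : ∀ k : ℕ, t * ((-t) ^ k / ((k.factorial : ℝ) * (k + (ν + 2)).factorial)) =
      -((k + 1 : ℕ) * ((-t) ^ (k + 1) / (((k + 1).factorial : ℝ) * (k + 1 + (ν + 1)).factorial))) := by
    intro k
    have e1 : k + (ν + 2) = k + 1 + (ν + 1) := by ring
    have h2 : (k.factorial : ℝ) ≠ 0 := by exact_mod_cast (Nat.factorial_pos _).ne'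
    have h3 : ((k + 1 + (ν + 1)).factorial : ℝ) ≠ 0 := by exact_mod_cast (Nat.factorial_pos _).ne'
    have h4 : (k + 1 : ℝ) ≠ 0 := by positivity
    rw [e1, Nat.factorial_succ k]
    push_cast
    field_simp
    ring
  have hs' : Summable fun k : ℕ => (k : ℝ) * ((-t) ^ k / ((k.factorial : ℝ) * (k + (ν + 1)).factorial)) := by
    rw [← summable_nat_add_iff 1]
    have := (hs.mul_left t).neg
    refine this.congr fun k => ?_
    rw [e k, neg_neg]
  have e2 : t * besselClifford (ν + 2) t =
      -∑' k : ℕ, (k : ℝ) * ((-t) ^ k / ((k.factorial : ℝ) * (k + (ν + 1)).factorial)) := by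
    rw [hs'.tsum_eq_zero_add, besselClifford, ← tsum_mul_left, tsum_congr e, tsum_neg]
    simp
  rw [e2, sub_neg_eq_add, besselClifford, besselClifford, ← tsum_mul_left,
    ← ((summable_besselClifford (ν + 1) t).mul_left _).tsum_add hs']
  refine tsum_congr fun k => ?_
  have h2 : (k.factorial : ℝ) ≠ 0 := by exact_mod_cast (Nat.factorial_pos _).ne'
  have h3 : ((k + ν).factorial : ℝ) ≠ 0 := by exact_mod_cast (Nat.factorial_pos _).ne'
  have h4 : (k + ν + 1 : ℝ) ≠ 0 := by positivity
  rw [← add_assoc k ν 1, Nat.factorial_succ (k + ν)]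
  push_cast
  field_simp
  ring

/-- By the recurrence, the derivative of the left side is `-(2ν + 1) * besselClifford (ν + 1) t ^ 2
≤ 0`, so the left side is at most its value at `0`. The first summand yields boundedness of order
`ν`, the second decay of order `ν + 1`. -/
lemma besselClifford_energy (ν : ℕ) {t : ℝ} (ht : 0 ≤ t) :
    besselClifford ν t ^ 2 + t * besselClifford (ν + 1) t ^ 2 ≤ (1 / (ν.factorial : ℝ)) ^ 2 := by
  let E : ℝ → ℝ := fun t => besselClifford ν t ^ 2 + t * besselClifford (ν + 1) t ^ 2
  have hE (s : ℝ) : HasDerivAt E (-(2 * ν + 1) * besselClifford (ν + 1) s ^ 2) s := by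
    have h := ((hasDerivAt_besselClifford ν s).pow 2).add
      ((hasDerivAt_id s).mul ((hasDerivAt_besselClifford (ν + 1) s).pow 2))
    convert! h using 1
    have := besselClifford_recurrence ν s
    simp only [id, Pi.pow_apply, this]
    push_cast
    ring
  have hanti : AntitoneOn E (Set.Ici 0) := by
    refine antitoneOn_of_deriv_nonpos (convex_Ici 0)
      (fun s _ => (hE s).continuousAt.continuousWithinAt)
      (fun s _ => (hE s).differentiableAt.differentiableWithinAt) fun s _ => ?_
    rw [(hE s).deriv]
    have : 0 ≤ (2 * (ν : ℝ) + 1) * besselClifford (ν + 1) s ^ 2 := by positivity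
    linarith
  have := hanti (Set.mem_Ici.2 le_rfl) (Set.mem_Ici.2 ht) ht
  simpa [E, besselClifford_zero] using this

lemma abs_besselClifford_le (ν : ℕ) {t : ℝ} (ht : 0 ≤ t) :
    |besselClifford ν t| ≤ 1 / ν.factorial := by
  refine abs_le_of_sq_le_sq ?_ (by positivity)
  have := besselClifford_energy ν ht
  have : 0 ≤ t * besselClifford (ν + 1) t ^ 2 := by positivity
  linarith

lemma tendsto_besselClifford (ν : ℕ) :
    Tendsto (besselClifford (ν + 1)) atTop (𝓝 0) := by
  have h1 : Tendsto (fun t : ℝ => (1 / (ν.factorial : ℝ)) ^ 2 * t⁻¹) atTop (𝓝 0) := by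
    simpa only [mul_zero] using
      (tendsto_inv_atTop_zero (𝕜 := ℝ)).const_mul ((1 / (ν.factorial : ℝ)) ^ 2)
  have h2 : Tendsto (fun t : ℝ => besselClifford (ν + 1) t ^ 2) atTop (𝓝 0) := by
    refine tendsto_of_tendsto_of_tendsto_of_le_of_le' tendsto_const_nhds h1
      (Eventually.of_forall fun t => sq_nonneg _) ?_
    filter_upwards [eventually_gt_atTop 0] with t ht
    have := besselClifford_energy ν ht.le
    rw [← div_eq_mul_inv, le_div_iff₀ ht]
    nlinarith [sq_nonneg (besselClifford ν t)]
  have h3 := h2.sqrt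
  simp only [Real.sqrt_sq_eq_abs, Real.sqrt_zero] at h3
  exact (tendsto_zero_iff_abs_tendsto_zero _).2 h3

/-! ### Coefficient sequences whose exponential shifts decay -/

lemma tsum_exponential_moment (j : ℕ) (c t : ℝ) :
    HasSum (fun k : ℕ => t ^ k / k.factorial * ((-c) ^ (j + k) / ((j + k + 1).factorial : ℝ)))
      ((-c) ^ j * besselClifford (j + 1) (c * t)) := by
  have := (summable_besselClifford (j + 1) (c * t)).hasSum.mul_left ((-c) ^ j)
  convert! this using 2 with k
  have e : k + (j + 1) = j + k + 1 := by ring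
  rw [e, pow_add, ← neg_mul, mul_pow]
  field_simp

/-- The sum is the `(d + 1)`-st forward difference at `0` of a monomial of degree `j + 1 ≤ d + 1`.
-/
lemma alternating_moment (d j : ℕ) (hj : j ≤ d) :
    ∑ l ∈ Finset.range (d + 2), (-1 : ℝ) ^ (d + 1 - l) * (d + 1).choose l * (l : ℝ) ^ (j + 1) =
      if j = d then ((d + 1).factorial : ℝ) else 0 := by
  have h := fwdDiff_iter_eq_sum_shift (1 : ℝ) (fun r : ℝ => r ^ (j + 1)) (d + 1) 0
  have e : ∑ l ∈ Finset.range (d + 2), (-1 : ℝ) ^ (d + 1 - l) * (d + 1).choose l * (l : ℝ) ^ (j + 1)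
      = (fwdDiff (1 : ℝ))^[d + 1] (fun r : ℝ => r ^ (j + 1)) 0 := by
    rw [h]
    refine Finset.sum_congr rfl fun l _ => ?_
    simp [zsmul_eq_mul]
  rw [e]
  split_ifs with hjd
  · subst hjd
    rw [fwdDiff_iter_eq_factorial]; simp
  · rw [fwdDiff_iter_pow_eq_zero_of_lt (by omega)]; simp

/-- `β` combines the sequences `(-(a l)) ^ j / (j + 1)!` for `l ≤ d + 1`, with weights from a finite
difference that annihilates the first `d` terms. Each sequence is turned by the exponential shift
into a Bessel–Clifford function of `a l t`, whence the bounds and the decay of `P`. A small scale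
`a` shrinks the terms after `d` relative to the term `d`. -/
theorem exists_decaying_coefficients (d : ℕ) (W : ℕ → ℝ) (hW0 : ∀ j, 0 ≤ W j)
    (hW : ∀ b : ℝ, 0 ≤ b → Summable fun j : ℕ => b ^ j / (j + 1).factorial * W j)
    {ε : ℝ} (hε : 0 < ε) :
    ∃ (β : ℕ → ℝ) (M b : ℝ) (P : ℕ → ℝ → ℝ), 0 ≤ M ∧ 0 ≤ b ∧ (∀ j < d, β j = 0) ∧ β d = 1 ∧
      ∑' j, |β (j + (d + 1))| * W (j + (d + 1)) ≤ ε ∧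
      (∀ j, |β j| ≤ M * (b ^ j / (j + 1).factorial)) ∧
      (∀ j t, HasSum (fun k : ℕ => t ^ k / k.factorial * β (j + k)) (P j t)) ∧
      (∀ j t, 0 ≤ t → |P j t| ≤ M * (b ^ j / (j + 1).factorial)) ∧
      ∀ j, Tendsto (P j) atTop (𝓝 0) := by
  set κ : ℕ → ℝ := fun l => (-1 : ℝ) ^ (d + 1 - l) * (d + 1).choose l with hκ
  set S : ℝ := ∑ l ∈ Finset.range (d + 2), |κ l * l| with hS
  have hS0 : 0 ≤ S := Finset.sum_nonneg fun _ _ => abs_nonneg _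
  have hTs := hW (d + 1) (by positivity)
  set T : ℝ := ∑' j : ℕ, ((d : ℝ) + 1) ^ j / (j + 1).factorial * W j with hT
  have hT0 : 0 ≤ T := tsum_nonneg fun j => mul_nonneg (by positivity) (hW0 j)
  -- After normalisation the term `j > d` carries `a ^ (j - d) ≤ a`, so the weighted tail is at most
  -- `a * (S * T)`.
  set a : ℝ := min 1 (ε / (S * T + 1)) with ha
  have ha0 : 0 < a := lt_min one_pos (by positivity)
  have ha1 : a ≤ 1 := min_le_left _ _
  have haε : a * (S * T) ≤ ε := by
    have h1 : a ≤ ε / (S * T + 1) := min_le_right _ _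
    rw [le_div_iff₀ (by positivity)] at h1
    nlinarith
  -- Normalises `β d` to `1`: the difference gives `(d + 1)!`, leaving the factor `(-a) ^ d`.
  set c : ℝ := (-1) ^ d * (a ^ d)⁻¹ with hc
  have hcabs : |c| = (a ^ d)⁻¹ := by
    rw [hc, abs_mul, abs_pow, abs_neg, abs_one, one_pow, one_mul, abs_of_pos (by positivity)]
  set β : ℕ → ℝ := fun j => ∑ l ∈ Finset.range (d + 2),
    c * (κ l * l) * ((-(a * l)) ^ j / ((j + 1).factorial : ℝ)) with hβ
  set P : ℕ → ℝ → ℝ := fun j t => ∑ l ∈ Finset.range (d + 2),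
    c * (κ l * l) * ((-(a * l)) ^ j * besselClifford (j + 1) (a * l * t)) with hP
  have hbound (j : ℕ) (x : ℕ → ℝ) (hx : ∀ l, |x l| ≤ 1 / (j + 1).factorial) :
      |∑ l ∈ Finset.range (d + 2), c * (κ l * l) * ((-(a * l)) ^ j * x l)| ≤
        (a ^ d)⁻¹ * S * ((a * (d + 1)) ^ j / (j + 1).factorial) := by
    refine (Finset.abs_sum_le_sum_abs _ _).trans ?_
    rw [hS, Finset.mul_sum, Finset.sum_mul]
    refine Finset.sum_le_sum fun l hl => ?_
    rw [abs_mul, abs_mul, hcabs, abs_mul ((-(a * l)) ^ j), abs_pow, abs_neg,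
      abs_of_nonneg (by positivity : 0 ≤ a * (l : ℝ)), div_eq_mul_one_div]
    have hl' : (l : ℝ) ≤ d + 1 := by
      have := Finset.mem_range.1 hl
      exact_mod_cast (by omega : l ≤ d + 1)
    gcongr
    exact hx l
  have hβform (j : ℕ) : β j = c * (-a) ^ j / ((j + 1).factorial : ℝ) *
      ∑ l ∈ Finset.range (d + 2), κ l * (l : ℝ) ^ (j + 1) := by
    rw [hβ, Finset.mul_sum]
    refine Finset.sum_congr rfl fun l _ => ?_
    rw [← neg_mul, mul_pow, pow_succ (l : ℝ)]
    ring
  have hβle (j : ℕ) : |β j| ≤ (a ^ d)⁻¹ * S * ((a * (d + 1)) ^ j / (j + 1).factorial) := by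
    have := hbound j (fun _ => 1 / (j + 1).factorial) fun _ => (abs_of_pos (by positivity)).le
    simpa only [hβ, ← div_eq_mul_one_div] using this
  refine ⟨β, (a ^ d)⁻¹ * S, a * (d + 1), P, by positivity, by positivity, ?_, ?_, ?_, hβle, ?_,
    ?_, ?_⟩
  · intro j hj
    rw [hβform, alternating_moment d j hj.le, if_neg hj.ne, mul_zero]
  · rw [hβform, alternating_moment d d le_rfl, if_pos rfl, hc]
    have : ((d + 1).factorial : ℝ) ≠ 0 := by positivity
    have h2 : (-1 : ℝ) ^ d * (-1) ^ d = 1 := by rw [← mul_pow]; simp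
    rw [neg_pow a]
    field_simp
    linear_combination h2
  · have hle (j : ℕ) : |β (j + (d + 1))| * W (j + (d + 1)) ≤ a * S *
        (((d : ℝ) + 1) ^ (j + (d + 1)) / (j + (d + 1) + 1).factorial * W (j + (d + 1))) := by
      rw [← mul_assoc]
      refine mul_le_mul_of_nonneg_right ((hβle _).trans ?_) (hW0 _)
      have e : (a ^ d)⁻¹ * S * ((a * (d + 1)) ^ (j + (d + 1)) / (j + (d + 1) + 1).factorial) =
          a ^ j * (a * S * (((d : ℝ) + 1) ^ (j + (d + 1)) / (j + (d + 1) + 1).factorial)) := by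
        rw [mul_pow, pow_add a, pow_succ a]
        have := (pow_pos ha0 d).ne'
        field_simp
      rw [e]
      exact mul_le_of_le_one_left (by positivity) (pow_le_one₀ ha0.le ha1)
    have hs := ((summable_nat_add_iff (d + 1)).2 hTs).mul_left (a * S)
    refine ((Summable.of_nonneg_of_le (fun j => mul_nonneg (abs_nonneg _) (hW0 _))
      hle hs).tsum_le_tsum hle hs).trans ?_
    rw [tsum_mul_left]
    refine le_trans ?_ haε
    rw [mul_assoc]
    gcongr
    rw [hT, ← hTs.sum_add_tsum_nat_add (d + 1)]
    exact le_add_of_nonneg_left (Finset.sum_nonneg fun j _ => mul_nonneg (by positivity) (hW0 j))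
  · intro j t
    have := hasSum_sum (s := Finset.range (d + 2)) fun l _ =>
      (tsum_exponential_moment j (a * l) t).mul_left (c * (κ l * l))
    convert! this using 2 with k
    rw [hβ, Finset.mul_sum]
    exact Finset.sum_congr rfl fun l _ => by ring
  · intro j t ht
    exact hbound j _ fun l => abs_besselClifford_le _ (by positivity)
  · intro j
    rw [show (0 : ℝ) = ∑ l ∈ Finset.range (d + 2), (0 : ℝ) by simp]
    refine tendsto_finsetSum _ fun l _ => ?_
    -- The function for `l = 0` is constant in `t` and would not decay; the extra factor `l` in the
    -- weights removes it.
    rcases Nat.eq_zero_or_pos l with rfl | hl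
    · simp
    · have : Tendsto (fun t : ℝ => a * l * t) atTop atTop :=
        tendsto_id.const_mul_atTop (by positivity)
      simpa using (((tendsto_besselClifford j).comp this).const_mul ((-(a * l)) ^ j)).const_mul
        (c * (κ l * l))

/-! ### Jordan chains and the exponential -/

section Chains

variable {𝕜 X : Type*} [RCLike 𝕜] [NormedAddCommGroup X] [NormedSpace 𝕜 X]

/-- `f 0, …, f D` is a Jordan chain of `K` for the eigenvalue `0`. -/
def IsJordanChain (K : X →L[𝕜] X) (f : ℕ → X) (D : ℕ) : Prop :=
  K (f 0) = 0 ∧ ∀ j < D, K (f (j + 1)) = f j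

lemma IsJordanChain.pow_apply {K : X →L[𝕜] X} {f : ℕ → X} {D : ℕ} (h : IsJordanChain K f D)
    (k j : ℕ) (hj : j + k ≤ D) : (K ^ k) (f (j + k)) = f j := by
  induction k with
  | zero => simp
  | succ k ih =>
    rw [pow_succ, mul_apply_eq_comp, ← add_assoc, h.2 _ (by omega), ih (by omega)]

lemma IsJordanChain.pow_apply_eq_zero {K : X →L[𝕜] X} {f : ℕ → X} {D : ℕ}
    (h : IsJordanChain K f D) (k j : ℕ) (hj : j ≤ D) (hk : j < k) : (K ^ k) (f j) = 0 := by
  obtain ⟨m, rfl⟩ := Nat.exists_eq_add_of_lt hk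
  have := h.pow_apply j 0 (by omega)
  rw [zero_add] at this
  rw [show j + m + 1 = m + 1 + j by ring, pow_add, mul_apply_eq_comp, this, pow_succ,
    mul_apply_eq_comp, h.1, map_zero]

lemma IsJordanChain.neg {K : X →L[𝕜] X} {f : ℕ → X} {D : ℕ} (h : IsJordanChain K f D) :
    IsJordanChain (-K) (fun j => (-1 : 𝕜) ^ j • f j) D := by
  refine ⟨by simp [h.1], fun j hj => ?_⟩
  simp [h.2 j hj, pow_succ]

variable [CompleteSpace X]

lemma exp_pow_apply_eq_tsum (K : X →L[𝕜] X) (n : ℕ) (x : X) :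
    HasSum (fun k : ℕ => (((n : ℝ) ^ k / k.factorial : ℝ) : 𝕜) • (K ^ k) x)
      ((NormedSpace.exp K ^ n) x) := by
  let _ : NormedAlgebra ℚ (X →L[𝕜] X) := NormedAlgebra.restrictScalars ℚ 𝕜 (X →L[𝕜] X)
  rw [← NormedSpace.exp_nsmul]
  have h := NormedSpace.exp_series_hasSum_exp' (𝕂 := 𝕜) (n • K)
  have h2 := h.mapL (ContinuousLinearMap.apply 𝕜 X x)
  convert! h2 using 2 with k
  rw [← Nat.cast_smul_eq_nsmul 𝕜, smul_pow, ContinuousLinearMap.apply_apply,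
    smul_apply, smul_apply, smul_smul]
  congr 1
  push_cast
  rw [div_eq_inv_mul]

lemma IsJordanChain.exp_pow_apply {K : X →L[𝕜] X} {f : ℕ → X} {D : ℕ} (h : IsJordanChain K f D)
    (n j : ℕ) (hj : j ≤ D) : (NormedSpace.exp K ^ n) (f j) =
      ∑ i ∈ Finset.range (j + 1), (((n : ℝ) ^ (j - i) / (j - i).factorial : ℝ) : 𝕜) • f i := by
  refine (exp_pow_apply_eq_tsum K n (f j)).unique ?_
  rw [← Finset.sum_range_reflect]
  have : HasSum (fun k : ℕ => (((n : ℝ) ^ k / k.factorial : ℝ) : 𝕜) • (K ^ k) (f j))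
      (∑ k ∈ Finset.range (j + 1), (((n : ℝ) ^ k / k.factorial : ℝ) : 𝕜) • (K ^ k) (f j)) := by
    refine hasSum_sum_of_ne_finset_zero fun k hk => ?_
    rw [h.pow_apply_eq_zero k j hj (by simpa [Nat.lt_succ_iff] using hk), smul_zero]
  convert! this using 1
  refine Finset.sum_congr rfl fun k hk => ?_
  have hk' : k ≤ j := by simpa [Nat.lt_succ_iff] using hk
  have e1 : j + 1 - 1 - k = j - k := by omega
  have e2 : j - (j - k) = k := by omega
  have := h.pow_apply k (j - k) (by omega)
  rw [Nat.sub_add_cancel hk'] at this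
  rw [e1, e2, this]

lemma IsJordanChain.exp_pow_apply_sum {K : X →L[𝕜] X} {f : ℕ → X} {D : ℕ}
    (h : IsJordanChain K f D) (β : ℕ → ℝ) (n : ℕ) :
    (NormedSpace.exp K ^ n) (∑ j ∈ Finset.range (D + 1), (β j : 𝕜) • f j) =
      ∑ i ∈ Finset.range (D + 1), ((∑ k ∈ Finset.range (D + 1 - i),
        (n : ℝ) ^ k / k.factorial * β (i + k) : ℝ) : 𝕜) • f i := by
  rw [map_sum]
  have := Finset.sum_range_diag_flip (D + 1) fun i k : ℕ =>
    (((n : ℝ) ^ k / k.factorial * β (i + k) : ℝ) : 𝕜) • f i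
  simp only [RCLike.ofReal_sum, Finset.sum_smul]
  rw [← this]
  refine Finset.sum_congr rfl fun j hj => ?_
  rw [map_smul, h.exp_pow_apply n j (by simpa [Nat.lt_succ_iff] using hj), Finset.smul_sum]
  refine Finset.sum_congr rfl fun i hi => ?_
  have hi' : i ≤ j := by simpa [Nat.lt_succ_iff] using hi
  rw [smul_smul, Nat.add_sub_cancel' hi', ← RCLike.ofReal_mul, mul_comm]

end Chains

/-! ### Decaying orbits carried by long chains -/

/-- A norm bound for Jordan chains: `∑ b ^ j / (j + 1)! * W j` converges for all `b`. -/
structure IsChainWeight (W : ℕ → ℝ) : Prop where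
  nonneg : ∀ j, 0 ≤ W j
  mono : Monotone W
  summable : ∀ b : ℝ, 0 ≤ b → Summable fun j : ℕ => b ^ j / (j + 1).factorial * W j

/-- Each omitted term is estimated by `t ^ k / k! ≤ exp t` and `W i ≤ W (i + k)`, which leaves a
tail independent of `i`. -/
lemma truncation_error {W β : ℕ → ℝ} {M b : ℝ} {P : ℕ → ℝ → ℝ} (hW : IsChainWeight W)
    (hM : 0 ≤ M) (hb : 0 ≤ b) (hβ : ∀ j, |β j| ≤ M * (b ^ j / (j + 1).factorial))
    (hP : ∀ j t, HasSum (fun k : ℕ => t ^ k / k.factorial * β (j + k)) (P j t))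
    {t : ℝ} (ht : 0 ≤ t) {D i : ℕ} (hi : i ≤ D) :
    |P i t - ∑ k ∈ Finset.range (D + 1 - i), t ^ k / k.factorial * β (i + k)| * W i ≤
      Real.exp t * (M * ∑' m : ℕ, b ^ (m + (D + 1)) / (m + (D + 1) + 1).factorial * W (m + (D + 1))) := by
  have hs := (hP i t).summable
  rw [← (hP i t).tsum_eq, ← hs.sum_add_tsum_nat_add (D + 1 - i), add_sub_cancel_left]
  have hu := (((summable_nat_add_iff (D + 1)).2 (hW.summable b hb)).mul_left M).mul_left (Real.exp t)
  rw [← abs_of_nonneg (hW.nonneg i), ← abs_mul, ← tsum_mul_right, ← tsum_mul_left, ← tsum_mul_left]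
  rw [← Real.norm_eq_abs]
  refine tsum_of_norm_bounded hu.hasSum fun m => ?_
  have e : i + (m + (D + 1 - i)) = m + (D + 1) := by omega
  rw [e, Real.norm_eq_abs, abs_mul, abs_mul, abs_of_nonneg (hW.nonneg i),
    abs_of_nonneg (by positivity : 0 ≤ t ^ (m + (D + 1 - i)) / ((m + (D + 1 - i)).factorial : ℝ)),
    mul_assoc]
  have h1 := Real.pow_div_factorial_le_exp t ht (m + (D + 1 - i))
  have h2 := hβ (m + (D + 1))
  have h3 := hW.mono (show i ≤ m + (D + 1) by omega)
  have h4 := hW.nonneg i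
  rw [← mul_assoc M]
  gcongr

/-- The vector is the truncation at `D` of `∑ β j • f j`. Its orbit is compared with `∑ |P j i| * W
j`, which tends to `0` by dominated convergence. The order of quantifiers is what matters later: `C`
and `n₀` depend on neither `n` nor the operator; only the required chain length depends on `n`. -/
theorem exists_decaying_orbit (d : ℕ) {W : ℕ → ℝ} (hW : IsChainWeight W) {ε : ℝ} (hε : 0 < ε)
    (𝕜 X : Type*) [RCLike 𝕜] [NormedAddCommGroup X] [NormedSpace 𝕜 X] [CompleteSpace X] :
    ∃ (C : ℝ) (n₀ : ℕ), ∀ n : ℕ, ∃ D₀ : ℕ, ∀ D ≥ D₀, ∀ (K : X →L[𝕜] X) (f : ℕ → X),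
      IsJordanChain K f D → (∀ j ≤ D, ‖f j‖ ≤ W j) → ∃ y : X, ‖y - f d‖ ≤ ε ∧
        (∀ i ≤ n, ‖(NormedSpace.exp K ^ i) y‖ ≤ C) ∧
        ∀ i ≤ n, n₀ ≤ i → ‖(NormedSpace.exp K ^ i) y‖ ≤ ε := by
  obtain ⟨β, M, b, P, hM, hb, hβ0, hβ1, hβs, hβ, hP, hPle, hPt⟩ :=
    exists_decaying_coefficients d W hW.nonneg hW.summable hε
  have hu := (hW.summable b hb).mul_left M
  set u : ℕ → ℝ := fun j => M * (b ^ j / (j + 1).factorial * W j) with hudef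
  have hPu (j : ℕ) (t : ℝ) (ht : 0 ≤ t) : |P j t| * W j ≤ u j := by
    rw [hudef]; simp only; rw [← mul_assoc]
    exact mul_le_mul_of_nonneg_right (hPle j t ht) (hW.nonneg j)
  have hPn (j : ℕ) (t : ℝ) : 0 ≤ |P j t| * W j := mul_nonneg (abs_nonneg _) (hW.nonneg j)
  have hPs (t : ℝ) (ht : 0 ≤ t) : Summable fun j => |P j t| * W j :=
    Summable.of_nonneg_of_le (fun j => hPn j t) (fun j => hPu j t ht) hu
  have hQ : Tendsto (fun t : ℝ => ∑' j, |P j t| * W j) atTop (𝓝 0) := by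
    have : Tendsto (fun t : ℝ => ∑' j, |P j t| * W j) atTop (𝓝 (∑' j : ℕ, (0 : ℝ))) := by
      refine tendsto_tsum_of_dominated_convergence (bound := u) hu (fun j => ?_) ?_
      · simpa using ((hPt j).abs).mul_const (W j)
      · filter_upwards [eventually_ge_atTop 0] with t ht j
        rw [Real.norm_of_nonneg (hPn j t)]
        exact hPu j t ht
    simpa using this
  obtain ⟨n₀, hn₀⟩ := (((hQ.comp tendsto_natCast_atTop_atTop).eventually
    (gt_mem_nhds (half_pos hε))).exists_forall_of_atTop)
  -- The base `2 * b` instead of `b` leaves room for the factor `D + 1 ≤ 2 ^ (m + (D + 1))` that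
  -- appears when the truncation errors of all `D + 1` coefficients are added.
  have htail : Tendsto (fun D : ℕ => ∑' m : ℕ,
      ((2 * b) ^ (m + D) / (m + D + 1).factorial * W (m + D))) atTop (𝓝 0) :=
    tendsto_sum_nat_add fun j : ℕ => (2 * b) ^ j / (j + 1).factorial * W j
  refine ⟨(∑' j, u j) + ε, n₀, fun n => ?_⟩
  have htail2 := ((htail.const_mul (Real.exp n * M)).comp (tendsto_add_atTop_nat 1)).eventually
    (gt_mem_nhds (by rw [mul_zero]; exact half_pos hε))
  obtain ⟨D₀, hD₀⟩ := htail2.exists_forall_of_atTop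
  refine ⟨max D₀ d, fun D hD K f hKf hf => ⟨∑ j ∈ Finset.range (D + 1), (β j : 𝕜) • f j, ?_, ?_⟩⟩
  · have hdD : d ≤ D := (le_max_right _ _).trans hD
    have e : D + 1 = d + 1 + (D - d) := by omega
    rw [e, Finset.sum_range_add, Finset.sum_range_succ, hβ1, Finset.sum_eq_zero fun j hj => by
      rw [hβ0 j (Finset.mem_range.1 hj)]; simp]
    simp only [zero_add, RCLike.ofReal_one, one_smul, add_sub_cancel_left]
    refine (norm_sum_le _ _).trans (le_trans (Finset.sum_le_sum fun j hj => ?_)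
      (le_trans (Summable.sum_le_tsum (f := fun j => |β (j + (d + 1))| * W (j + (d + 1)))
        (Finset.range (D - d)) (fun j _ => mul_nonneg (abs_nonneg _) (hW.nonneg _)) ?_) hβs))
    · rw [norm_smul, RCLike.norm_ofReal, add_comm (d + 1)]
      have := Finset.mem_range.1 hj
      exact mul_le_mul_of_nonneg_left (hf _ (by omega)) (abs_nonneg _)
    · refine Summable.of_nonneg_of_le (fun j => mul_nonneg (abs_nonneg _) (hW.nonneg _))
        (fun j => ?_) ((summable_nat_add_iff (d + 1)).2 hu)
      rw [hudef]; simp only; rw [← mul_assoc]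
      exact mul_le_mul_of_nonneg_right (hβ _) (hW.nonneg _)
  · have key (i : ℕ) (hi : i ≤ n) : ‖(NormedSpace.exp K ^ i)
        (∑ j ∈ Finset.range (D + 1), (β j : 𝕜) • f j)‖ ≤ (∑' j, |P j i| * W j) + ε / 2 := by
      rw [hKf.exp_pow_apply_sum]
      refine (norm_sum_le _ _).trans ?_
      set E : ℝ := Real.exp n * (M * ∑' m : ℕ,
        b ^ (m + (D + 1)) / (m + (D + 1) + 1).factorial * W (m + (D + 1))) with hE
      have h1 : ∀ l ∈ Finset.range (D + 1), ‖((∑ k ∈ Finset.range (D + 1 - l),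
          (i : ℝ) ^ k / k.factorial * β (l + k) : ℝ) : 𝕜) • f l‖ ≤ |P l i| * W l + E := by
        intro l hl
        have hl' : l ≤ D := by simpa [Nat.lt_succ_iff] using hl
        have h2 := truncation_error hW hM hb hβ hP (Nat.cast_nonneg i : (0 : ℝ) ≤ i) hl'
        have h3 : Real.exp i ≤ Real.exp n := Real.exp_le_exp.2 (by exact_mod_cast hi)
        have h4 : 0 ≤ M * ∑' m : ℕ, b ^ (m + (D + 1)) / (m + (D + 1) + 1).factorial * W (m + (D + 1)) :=
          mul_nonneg hM (tsum_nonneg fun m => mul_nonneg (by positivity) (hW.nonneg _))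
        have h5 := mul_le_mul_of_nonneg_right h3 h4
        rw [norm_smul, RCLike.norm_ofReal]
        refine (mul_le_mul_of_nonneg_left (hf l hl') (abs_nonneg _)).trans ?_
        have h6 := mul_le_mul_of_nonneg_right (abs_sub_abs_le_abs_sub
          (∑ k ∈ Finset.range (D + 1 - l), (i : ℝ) ^ k / k.factorial * β (l + k)) (P l i))
          (hW.nonneg l)
        rw [abs_sub_comm] at h6
        linarith
      refine (Finset.sum_le_sum h1).trans ?_
      rw [Finset.sum_add_distrib]
      refine add_le_add ((hPs i (Nat.cast_nonneg i)).sum_le_tsum _ fun j _ => hPn j i) ?_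
      have h7 := (hD₀ D ((le_max_left _ _).trans hD)).le
      refine le_trans ?_ h7
      simp only [Function.comp, Finset.sum_const, Finset.card_range, nsmul_eq_mul]
      rw [hE, mul_left_comm, mul_assoc, mul_left_comm _ M]
      refine mul_le_mul_of_nonneg_left (mul_le_mul_of_nonneg_left ?_ hM) (Real.exp_pos _).le
      rw [← tsum_mul_left]
      refine Summable.tsum_le_tsum (fun m => ?_)
        (((summable_nat_add_iff (D + 1)).2 (hW.summable b hb)).mul_left _)
        ((summable_nat_add_iff (D + 1)).2 (hW.summable (2 * b) (by positivity)))
      rw [← mul_assoc]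
      refine mul_le_mul_of_nonneg_right ?_ (hW.nonneg _)
      rw [mul_pow, mul_div_assoc]
      refine mul_le_mul_of_nonneg_right ?_ (by positivity)
      have h8 : m + (D + 1) ≤ 2 ^ (m + (D + 1)) := Nat.lt_two_pow_self.le
      exact_mod_cast (by omega : D + 1 ≤ 2 ^ (m + (D + 1)))
    refine ⟨fun i hi => (key i hi).trans ?_, fun i hi hi' => (key i hi).trans ?_⟩
    · have := (hPs i (Nat.cast_nonneg i)).tsum_le_tsum (fun j => hPu j i (Nat.cast_nonneg i)) hu
      linarith
    · have := hn₀ i hi'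
      simp only [Function.comp] at this
      linarith

/-! ### A Dvoretzky–Rogers lemma by maximal determinants -/

section DvoretzkyRogers

variable {𝕜 : Type*} [RCLike 𝕜]

lemma det_one_add_smul_of_isProj {E : Type*} [AddCommGroup E] [Module 𝕜 E] [FiniteDimensional 𝕜 E]
    {W : Submodule 𝕜 E} {P : E →ₗ[𝕜] E} (hP : LinearMap.IsProj W P) (s : 𝕜) :
    LinearMap.det (1 + s • P) = (1 + s) ^ Module.finrank 𝕜 W := by
  have e : (1 + s • P : E →ₗ[𝕜] E) = (W.prodEquivOfIsCompl _ hP.isCompl).conj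
      (LinearMap.prodMap ((1 + s) • LinearMap.id) LinearMap.id) := by
    have h1 : LinearMap.prodMap ((1 + s) • (LinearMap.id : W →ₗ[𝕜] W))
        (LinearMap.id : P.ker →ₗ[𝕜] P.ker) =
        LinearMap.id + s • LinearMap.prodMap LinearMap.id 0 := by
      ext x <;> simp [add_smul]
    rw [h1, map_add, map_smul, ← hP.eq_conj_prodMap]
    congr 1
    ext x
    simp
  rw [e, LinearEquiv.conj_apply, LinearMap.comp_assoc, LinearMap.det_conj, LinearMap.det_prodMap,
    LinearMap.det_smul]
  simp

lemma le_of_one_add_pow_le {r n : ℕ} {c : ℝ}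
    (h : ∀ s : ℝ, 0 < s → (1 + s) ^ r ≤ (1 + s * c) ^ n) : (r : ℝ) ≤ n * c := by
  set g : ℝ → ℝ := fun s => (1 + s) ^ r - (1 + s * c) ^ n with hg
  have hd : HasDerivAt g (r - n * c) 0 := by
    have h1 := ((hasDerivAt_id (0 : ℝ)).const_add 1).pow r
    have h2 := (((hasDerivAt_id (0 : ℝ)).mul_const c).const_add 1).pow n
    convert! h1.sub h2 using 1
    simp
  have h0 : g 0 = 0 := by simp [hg]
  have h3 := hd.tendsto_slope_zero_right
  have h4 : (r : ℝ) - n * c ≤ 0 := by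
    refine le_of_tendsto h3 ?_
    filter_upwards [self_mem_nhdsWithin] with s hs
    have hs' : (0 : ℝ) < s := hs
    rw [h0, zero_add, sub_zero, smul_eq_mul]
    exact mul_nonpos_of_nonneg_of_nonpos (inv_pos.2 hs').le (sub_nonpos.2 (h s hs'))
  linarith

/-- Take `u` of maximal determinant in the unit ball. If `u` is bounded by `c` on `W`, then `u ∘ (1
+ s P_W)` has norm at most `1 + s c`, while its determinant has grown by `(1 + s) ^ dim W`.
Maximality gives `(1 + s) ^ dim W ≤ (1 + s c) ^ n`; compare derivatives at `s = 0`. -/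
lemma exists_contraction_large_on_subspaces {E : Type*} [NormedAddCommGroup E] [NormedSpace 𝕜 E]
    [FiniteDimensional 𝕜 E] {n : ℕ} (hn : Module.finrank 𝕜 E = n) :
    ∃ u : EuclideanSpace 𝕜 (Fin n) →L[𝕜] E, ‖u‖ ≤ 1 ∧
      ∀ (W : Submodule 𝕜 (EuclideanSpace 𝕜 (Fin n))) (c : ℝ), 0 ≤ c →
        (∀ w ∈ W, ‖u w‖ ≤ c * ‖w‖) → (Module.finrank 𝕜 W : ℝ) ≤ n * c := by
  -- An arbitrary identification, used only to make sense of the determinant of a map into `E`.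
  let A : E ≃L[𝕜] EuclideanSpace 𝕜 (Fin n) := ContinuousLinearEquiv.ofFinrankEq (by simp [hn])
  let δ : (EuclideanSpace 𝕜 (Fin n) →L[𝕜] E) → ℝ := fun u =>
    ‖((A : E →L[𝕜] EuclideanSpace 𝕜 (Fin n)).comp u).det‖
  have hδc : Continuous δ := by
    refine (ContinuousLinearMap.continuous_det.comp ?_).norm
    exact continuous_const.clm_comp continuous_id
  have hδs (t : ℝ) (ht : 0 ≤ t) (u : EuclideanSpace 𝕜 (Fin n) →L[𝕜] E) :
      δ ((t : 𝕜) • u) = t ^ n * δ u := by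
    simp only [δ, ContinuousLinearMap.comp_smul, ContinuousLinearMap.det,
      ContinuousLinearMap.toLinearMap_smul, LinearMap.det_smul, norm_mul, norm_pow]
    simp [abs_of_nonneg ht]
  have : ProperSpace (EuclideanSpace 𝕜 (Fin n) →L[𝕜] E) := FiniteDimensional.proper 𝕜 _
  obtain ⟨u, hu, hmax⟩ := (isCompact_closedBall (0 : EuclideanSpace 𝕜 (Fin n) →L[𝕜] E) 1).exists_isMaxOn
    ⟨0, by simp⟩ hδc.continuousOn
  have hu1 : ‖u‖ ≤ 1 := by simpa using hu
  have hmax' (v : EuclideanSpace 𝕜 (Fin n) →L[𝕜] E) (t : ℝ) (ht : 0 < t) (hv : ‖v‖ ≤ t) :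
      δ v ≤ t ^ n * δ u := by
    have h1 : ‖((t⁻¹ : ℝ) : 𝕜) • v‖ ≤ 1 := by
      rw [norm_smul, RCLike.norm_ofReal, abs_of_pos (inv_pos.2 ht), inv_mul_le_iff₀ ht, mul_one]
      exact hv
    have h2 : δ (((t⁻¹ : ℝ) : 𝕜) • v) ≤ δ u := hmax (by simpa using h1)
    rw [hδs _ (inv_pos.2 ht).le, inv_pow, inv_mul_le_iff₀ (pow_pos ht n)] at h2
    exact h2
  have hpos : 0 < δ u := by
    have h1 := hmax' (A.symm : EuclideanSpace 𝕜 (Fin n) →L[𝕜] E)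
      (‖(A.symm : EuclideanSpace 𝕜 (Fin n) →L[𝕜] E)‖ + 1) (by positivity) (by linarith)
    have h2 : δ (A.symm : EuclideanSpace 𝕜 (Fin n) →L[𝕜] E) = 1 := by
      simp [δ, ContinuousLinearMap.det]
    rw [h2] at h1
    by_contra! h3
    have : (‖(A.symm : EuclideanSpace 𝕜 (Fin n) →L[𝕜] E)‖ + 1) ^ n * δ u ≤ 0 :=
      mul_nonpos_of_nonneg_of_nonpos (by positivity) h3
    linarith
  refine ⟨u, hu1, fun W c hc hW => le_of_one_add_pow_le fun s hs => ?_⟩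
  have hproj : LinearMap.IsProj W (W.starProjection : EuclideanSpace 𝕜 (Fin n) →ₗ[𝕜] _) :=
    ⟨fun x => W.starProjection_apply_mem x, fun x hx => W.starProjection_eq_self_iff.2 hx⟩
  have hnorm : ‖u.comp (1 + (s : 𝕜) • W.starProjection)‖ ≤ 1 + s * c := by
    refine ContinuousLinearMap.opNorm_le_bound _ (by positivity) fun x => ?_
    have h1 : ‖u x‖ ≤ 1 * ‖x‖ := u.le_of_opNorm_le hu1 x
    have h2 := hW _ (W.starProjection_apply_mem x)
    have h3 : ‖W.starProjection x‖ ≤ ‖x‖ := W.norm_starProjection_apply_le x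
    have h4 : ‖u (W.starProjection x)‖ ≤ c * ‖x‖ := h2.trans (by gcongr)
    simp only [ContinuousLinearMap.comp_apply, add_apply, map_add,
      smul_apply, map_smul, one_apply_eq_self]
    refine (norm_add_le _ _).trans ?_
    rw [norm_smul, RCLike.norm_ofReal, abs_of_pos hs]
    nlinarith
  have h5 := hmax' _ _ (by positivity) hnorm
  have h6 : δ (u.comp (1 + (s : 𝕜) • W.starProjection)) =
      (1 + s) ^ Module.finrank 𝕜 W * δ u := by
    simp only [δ, ← ContinuousLinearMap.comp_assoc]
    simp only [ContinuousLinearMap.det]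
    rw [ContinuousLinearMap.toLinearMap_comp, LinearMap.det_comp, norm_mul, mul_comm]
    congr 1
    have := det_one_add_smul_of_isProj hproj (s : 𝕜)
    rw [show ((1 + (s : 𝕜) • W.starProjection : EuclideanSpace 𝕜 (Fin n) →L[𝕜] _) :
      EuclideanSpace 𝕜 (Fin n) →ₗ[𝕜] _) = 1 + (s : 𝕜) • W.starProjection.toLinearMap from rfl,
      this, norm_pow]
    congr 1
    rw [← RCLike.ofReal_one, ← RCLike.ofReal_add, RCLike.norm_ofReal, abs_of_pos (by positivity)]
  rw [h6] at h5
  exact le_of_mul_le_mul_right h5 hpos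

/-- Greedy choice: the orthogonal complement of the vectors already found has dimension greater than
`n * c`, so `u` cannot be smaller than `c` on its whole unit sphere. -/
lemma exists_orthonormal_large {E : Type*} [NormedAddCommGroup E] [NormedSpace 𝕜 E] {n : ℕ}
    {u : EuclideanSpace 𝕜 (Fin n) →L[𝕜] E}
    (hu : ∀ (W : Submodule 𝕜 (EuclideanSpace 𝕜 (Fin n))) (c : ℝ), 0 ≤ c →
        (∀ w ∈ W, ‖u w‖ ≤ c * ‖w‖) → (Module.finrank 𝕜 W : ℝ) ≤ n * c)
    {c : ℝ} (hc : 0 ≤ c) (m : ℕ) (hm : n * c + m < n + 1) :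
    ∃ z : Fin m → EuclideanSpace 𝕜 (Fin n), Orthonormal 𝕜 z ∧ ∀ i, c ≤ ‖u (z i)‖ := by
  induction m with
  | zero => exact ⟨Fin.elim0, ⟨fun i => i.elim0, fun i => i.elim0⟩, fun i => i.elim0⟩
  | succ m ih =>
    push_cast at hm
    obtain ⟨z, hz, hzc⟩ := ih (by linarith)
    have hdim := Submodule.finrank_add_finrank_orthogonal (Submodule.span 𝕜 (Set.range z))
    rw [finrank_span_eq_card hz.linearIndependent, Fintype.card_fin, finrank_euclideanSpace_fin]
      at hdim
    have hex : ∃ w ∈ (Submodule.span 𝕜 (Set.range z))ᗮ, ‖w‖ = 1 ∧ c ≤ ‖u w‖ := by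
      by_contra! hcon
      have := hu _ c hc fun w hw => by
        rcases eq_or_ne w 0 with rfl | hw0
        · simp
        have hnw : 0 < ‖w‖ := norm_pos_iff.2 hw0
        have := (hcon (((‖w‖⁻¹ : ℝ) : 𝕜) • w) (Submodule.smul_mem _ _ hw)
          (by rw [norm_smul, RCLike.norm_ofReal, abs_of_pos (inv_pos.2 hnw),
                inv_mul_cancel₀ hnw.ne'])).le
        rw [map_smul, norm_smul, RCLike.norm_ofReal, abs_of_pos (inv_pos.2 hnw),
          inv_mul_le_iff₀ hnw] at this
        linarith
      have h2 : (m : ℝ) + Module.finrank 𝕜 (Submodule.span 𝕜 (Set.range z))ᗮ = n := by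
        exact_mod_cast hdim
      linarith
    obtain ⟨w, hw, hw1, hwc⟩ := hex
    have hwz (i : Fin m) : inner 𝕜 (z i) w = 0 :=
      (Submodule.mem_orthogonal _ _).1 hw _ (Submodule.subset_span ⟨i, rfl⟩)
    have hzw (i : Fin m) : inner 𝕜 w (z i) = 0 := inner_eq_zero_symm.1 (hwz i)
    refine ⟨Fin.cons w z, ?_, fun i => ?_⟩
    · rw [orthonormal_iff_ite] at hz ⊢
      intro i j
      refine Fin.cases ?_ (fun i => ?_) i <;> refine Fin.cases ?_ (fun j => ?_) j
      · simp [inner_self_eq_norm_sq_to_K, hw1]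
      · simp [hzw, (Fin.succ_ne_zero j).symm]
      · simp [hwz]
      · simpa using hz i j
    · refine Fin.cases ?_ (fun i => ?_) i
      · simpa using hwc
      · simpa using hzc i

/-- A form of the Dvoretzky–Rogers lemma. -/
theorem exists_biorthogonal_upper_two {Y : Type*} [NormedAddCommGroup Y] [NormedSpace 𝕜 Y]
    (hY : ¬ FiniteDimensional 𝕜 Y) (m : ℕ) :
    ∃ (h : Fin m → Y) (ψ : Fin m → Y →L[𝕜] 𝕜),
      (∀ i j, ψ i (h j) = if i = j then 1 else 0) ∧ (∀ i, ‖ψ i‖ ≤ 2) ∧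
      ∀ a : Fin m → 𝕜, ‖∑ i, a i • h i‖ ≤ √(∑ i, ‖a i‖ ^ 2) := by
  -- Large enough that `2 * m ^ 2 / n ≤ (1 / 4) ^ 2` in the Cauchy–Schwarz step below.
  set n : ℕ := 32 * m ^ 2 + 1 with hn
  obtain ⟨s, hs, hsl⟩ : ∃ s : Finset Y, s.card = n ∧ LinearIndependent 𝕜 ((↑) : s → Y) := by
    refine le_rank_iff_exists_linearIndependent_finset.1 ?_
    rw [← not_lt]
    intro hlt
    exact hY (Module.rank_lt_aleph0_iff.1 (hlt.trans (Cardinal.natCast_lt_aleph0)))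
  set E : Submodule 𝕜 Y := Submodule.span 𝕜 (s : Set Y) with hE
  have hfin : Module.finrank 𝕜 E = n := by
    rw [hE, finrank_span_finset_eq_card hsl, hs]
  have : FiniteDimensional 𝕜 E := FiniteDimensional.span_finset 𝕜 s
  obtain ⟨u, hu1, hu⟩ := exists_contraction_large_on_subspaces hfin
  have hn0 : (0 : ℝ) < n := by rw [hn]; positivity
  have hmn : 32 * (m : ℝ) ^ 2 ≤ n := by rw [hn]; push_cast; linarith
  have hm2 : (m : ℝ) ≤ (m : ℝ) ^ 2 := by
    rcases Nat.eq_zero_or_pos m with rfl | h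
    · simp
    · have : (1 : ℝ) ≤ m := by exact_mod_cast h
      nlinarith
  set c : ℝ := 1 - m / n with hc
  have hmn' : (m : ℝ) / n ≤ 1 / 32 := by rw [div_le_iff₀ hn0]; linarith
  obtain ⟨z, hz, hzc⟩ := exists_orthonormal_large hu (c := c) (by linarith) m (by
    rw [hc, mul_sub, mul_div_cancel₀ _ hn0.ne']; linarith)
  set h : Fin m → Y := fun i => (u (z i) : Y) with hh
  have hupper (a : Fin m → 𝕜) : ‖∑ i, a i • h i‖ ≤ √(∑ i, ‖a i‖ ^ 2) := by
    have e : ∑ i, a i • h i = ((u (∑ i, a i • z i) : E) : Y) := by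
      simp [hh, map_sum]
    rw [e]
    refine (u.le_of_opNorm_le hu1 _).trans ?_
    rw [one_mul]
    refine Real.le_sqrt_of_sq_le ?_
    have h1 := hz.inner_sum a a Finset.univ
    rw [inner_self_eq_norm_sq_to_K] at h1
    simp only [RCLike.conj_mul] at h1
    exact le_of_eq (by exact_mod_cast h1)
  have hlower (a : Fin m → 𝕜) (i : Fin m) : ‖a i‖ ≤ 2 * ‖∑ j, a j • h j‖ := by
    have : Nonempty (Fin m) := ⟨i⟩
    -- Test the sum against a functional `φ` norming `h k`, where `|a k|` is maximal. By Bessel's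
    -- inequality `∑ |φ (h j)| ^ 2 ≤ 1`, and `|φ (h k)|` is almost `1`, so the other terms
    -- contribute little.
    obtain ⟨k, hk⟩ := Finite.exists_max fun j => ‖a j‖
    refine (hk i).trans ?_
    have hhk : c ≤ ‖h k‖ := hzc k
    obtain ⟨φ, hφ1, hφ⟩ := exists_dual_vector 𝕜 (h k) (by linarith)
    have hsum : ∑ j, ‖φ (h j)‖ ^ 2 ≤ 1 := by
      set ψ : EuclideanSpace 𝕜 (Fin n) →L[𝕜] 𝕜 := (φ.comp E.subtypeL).comp u with hψ
      have hψ1 : ‖ψ‖ ≤ 1 := by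
        refine ContinuousLinearMap.opNorm_le_bound _ zero_le_one fun x => ?_
        have h1 : ‖φ (u x : Y)‖ ≤ 1 * ‖(u x : Y)‖ := φ.le_of_opNorm_le hφ1.le _
        have h2 : ‖(u x : Y)‖ ≤ 1 * ‖x‖ := u.le_of_opNorm_le hu1 x
        exact h1.trans (by linarith)
      have hB := hz.sum_inner_products_le ((InnerProductSpace.toDual 𝕜 _).symm ψ)
        (s := Finset.univ)
      rw [LinearIsometryEquiv.norm_map] at hB
      have e : ∀ j, ‖inner 𝕜 (z j) ((InnerProductSpace.toDual 𝕜 _).symm ψ)‖ = ‖φ (h j)‖ := by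
        intro j
        rw [norm_inner_symm, InnerProductSpace.toDual_symm_apply]
        rfl
      simp only [e] at hB
      exact hB.trans (pow_le_one₀ (norm_nonneg _) hψ1)
    have hsum' : ∑ j ∈ Finset.univ.erase k, ‖φ (h j)‖ ^ 2 ≤ 2 * (m / n) := by
      have := Finset.add_sum_erase Finset.univ (fun j => ‖φ (h j)‖ ^ 2) (Finset.mem_univ k)
      have h2 : c ^ 2 ≤ ‖φ (h k)‖ ^ 2 := by
        rw [hφ, RCLike.norm_ofReal, abs_norm]
        exact pow_le_pow_left₀ (by linarith) hhk 2
      nlinarith [sq_nonneg ((m : ℝ) / n)]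
    have hsum1 : ∑ j ∈ Finset.univ.erase k, ‖φ (h j)‖ ≤ 1 / 4 := by
      have h3 := sq_sum_le_card_mul_sum_sq (s := Finset.univ.erase k) (f := fun j => ‖φ (h j)‖)
      have h4 : ((Finset.univ.erase k).card : ℝ) ≤ m := by
        have := Finset.card_erase_le (s := Finset.univ) (a := k)
        simp only [Finset.card_univ, Fintype.card_fin] at this
        exact_mod_cast this
      refine le_of_sq_le_sq ?_ (by norm_num)
      refine h3.trans ((mul_le_mul h4 hsum' (Finset.sum_nonneg fun _ _ => sq_nonneg _)
        (Nat.cast_nonneg _)).trans ?_)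
      have : (m : ℝ) * (2 * (m / n)) = 2 * m ^ 2 / n := by ring
      rw [this, div_le_iff₀ hn0]
      linarith
    have hmain : φ (∑ j, a j • h j) = a k * φ (h k) + ∑ j ∈ Finset.univ.erase k, a j * φ (h j) := by
      rw [map_sum, ← Finset.add_sum_erase _ _ (Finset.mem_univ k)]
      simp
    have h5 : ‖∑ j ∈ Finset.univ.erase k, a j * φ (h j)‖ ≤ ‖a k‖ * (1 / 4) := by
      refine (norm_sum_le _ _).trans (le_trans ?_ (mul_le_mul_of_nonneg_left hsum1 (norm_nonneg _)))
      rw [Finset.mul_sum]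
      refine Finset.sum_le_sum fun j _ => ?_
      rw [norm_mul]
      exact mul_le_mul_of_nonneg_right (hk j) (norm_nonneg _)
    have h6 : ‖a k‖ * (3 / 4) ≤ ‖a k * φ (h k)‖ := by
      rw [norm_mul, hφ, RCLike.norm_ofReal, abs_norm]
      exact mul_le_mul_of_nonneg_left (by linarith) (norm_nonneg _)
    have h7 : ‖φ (∑ j, a j • h j)‖ ≤ 1 * ‖∑ j, a j • h j‖ := φ.le_of_opNorm_le hφ1.le _
    have h8 : ‖a k * φ (h k)‖ ≤ ‖φ (∑ j, a j • h j)‖ +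
        ‖∑ j ∈ Finset.univ.erase k, a j * φ (h j)‖ := by
      rw [hmain]
      exact norm_le_add_norm_add _ _
    linarith
  have hli : LinearIndependent 𝕜 h := by
    rw [Fintype.linearIndependent_iff]
    intro g hg i
    have := hlower g i
    rw [hg, norm_zero, mul_zero] at this
    exact norm_le_zero_iff.1 this
  set b := Module.Basis.span hli with hb
  have hex (i : Fin m) : ∃ ψ : Y →L[𝕜] 𝕜, (∀ j, ψ (h j) = if i = j then 1 else 0) ∧ ‖ψ‖ ≤ 2 := by
    set f : (Submodule.span 𝕜 (Set.range h)) →L[𝕜] 𝕜 := (b.coord i).mkContinuous 2 fun x => by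
      have hx : ∑ j, b.repr x j • h j = (x : Y) := by
        conv_rhs => rw [← b.sum_repr x]
        simp [hb, Module.Basis.span_apply]
      have := hlower (fun j => b.repr x j) i
      rw [hx] at this
      exact this
    have hf (x) : f x = b.repr x i := rfl
    obtain ⟨ψ, hψ, hψn⟩ := exists_extension_norm_eq _ f
    refine ⟨ψ, fun j => ?_, ?_⟩
    · have e : h j = ((b j : Submodule.span 𝕜 (Set.range h)) : Y) := by
        rw [hb, Module.Basis.span_apply]
      rw [e, hψ, hf, b.repr_self, Finsupp.single_apply]
      simp [eq_comm]
    · rw [hψn]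
      exact LinearMap.mkContinuous_norm_le _ (by norm_num) _
  choose ψ hψ1 hψ2 using hex
  exact ⟨h, ψ, hψ1, hψ2, hupper⟩

end DvoretzkyRogers

/-! ### Prolonging Jordan chains by small perturbations -/

section Perturbation

variable {𝕜 X : Type*} [RCLike 𝕜] [NormedAddCommGroup X] [NormedSpace 𝕜 X]

variable (𝕜 X) in
/-- The nilpotent operators of finite rank. -/
def finiteRankNilpotent : Set (X →L[𝕜] X) :=
  {N | IsNilpotent N ∧ ∃ F : Submodule 𝕜 X, FiniteDimensional 𝕜 F ∧ ∀ x, N x ∈ F}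

lemma not_finiteDimensional_ker {F : Type*} [AddCommGroup F] [Module 𝕜 F] [FiniteDimensional 𝕜 F]
    (hX : ¬ FiniteDimensional 𝕜 X) (A : X →ₗ[𝕜] F) : ¬ FiniteDimensional 𝕜 A.ker := by
  intro h
  have : Module.Finite 𝕜 (X ⧸ A.ker) := Module.Finite.equiv A.quotKerEquivRange.symm
  exact hX (Module.Finite.of_submodule_quotient A.ker)

/-- The system lives in the common kernel of `N` and of a projection `Q` onto `G`, which is
infinite-dimensional. Composing the extended functionals with `1 - Q` makes them vanish on `G` at a
cost `‖1 - Q‖` that does not depend on `m`. -/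
lemma exists_biorthogonal_in_kernel (hX : ¬ FiniteDimensional 𝕜 X) (N : X →L[𝕜] X)
    (G : Submodule 𝕜 X) [FiniteDimensional 𝕜 G] (hN : ∀ x, N x ∈ G) :
    ∃ C : ℝ, 0 ≤ C ∧ ∀ m : ℕ, ∃ (h : ℕ → X) (ψ : ℕ → X →L[𝕜] 𝕜), (∀ i, N (h i) = 0) ∧
      (∀ i, ∀ x ∈ G, ψ i x = 0) ∧ (∀ i < m, ∀ j < m, ψ i (h j) = if i = j then 1 else 0) ∧
      (∀ i, ‖ψ i‖ ≤ C) ∧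
      ∀ a : ℕ → 𝕜, ∀ s : Finset ℕ, ‖∑ i ∈ s, a i • h i‖ ≤ √(∑ i ∈ s, ‖a i‖ ^ 2) := by
  obtain ⟨Q, hQ⟩ := Submodule.ClosedComplemented.of_finiteDimensional G
  set A : X →ₗ[𝕜] G × G := (Q : X →ₗ[𝕜] G).prod ((N : X →ₗ[𝕜] X).codRestrict G hN) with hA
  have hM := not_finiteDimensional_ker hX A
  have hmem (y : A.ker) : Q (y : X) = 0 ∧ N (y : X) = 0 := by
    have h0 : A (y : X) = 0 := y.2
    exact ⟨congrArg Prod.fst h0, congrArg (fun z => (z.2 : X)) h0⟩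
  set J : X →L[𝕜] X := ContinuousLinearMap.id 𝕜 X - G.subtypeL.comp Q with hJ
  refine ⟨2 * ‖J‖, by positivity, fun m => ?_⟩
  obtain ⟨h, ψ, hψh, hψ, hup⟩ := exists_biorthogonal_upper_two hM m
  have hext (i : Fin m) := exists_extension_norm_eq A.ker (ψ i)
  choose Ψ hΨ hΨn using hext
  refine ⟨fun i => if hi : i < m then (h ⟨i, hi⟩ : X) else 0,
    fun i => if hi : i < m then (Ψ ⟨i, hi⟩).comp J else 0, fun i => ?_, fun i x hx => ?_,
    fun i hi j hj => ?_, fun i => ?_, fun a s => ?_⟩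
  · beta_reduce
    split_ifs
    · exact (hmem _).2
    · simp
  · beta_reduce
    split_ifs
    · have : Q x = ⟨x, hx⟩ := hQ ⟨x, hx⟩
      simp [hJ, this]
    · simp
  · beta_reduce
    rw [dif_pos hi, dif_pos hj, ContinuousLinearMap.comp_apply, hJ]
    simp only [sub_apply, ContinuousLinearMap.comp_apply,
      ContinuousLinearMap.id_apply, (hmem _).1, map_zero, sub_zero]
    rw [hΨ, hψh]
    simp
  · beta_reduce
    split_ifs
    · refine (ContinuousLinearMap.opNorm_comp_le _ _).trans ?_
      rw [hΨn]
      exact mul_le_mul_of_nonneg_right (hψ _) (norm_nonneg _)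
    · simp
  · have e1 : ∑ i ∈ s, a i • (if hi : i < m then (h ⟨i, hi⟩ : X) else 0) =
        ((∑ i : Fin m, (if (i : ℕ) ∈ s then a i else 0) • h i : A.ker) : X) := by
      rw [Submodule.coe_sum]
      simp only [Submodule.coe_smul]
      have := Fin.sum_univ_eq_sum_range (fun i : ℕ => (if i ∈ s then a i else 0) •
        (if hi : i < m then (h ⟨i, hi⟩ : X) else 0)) m
      simp only [Fin.is_lt, dif_pos, Fin.eta] at this
      rw [this]
      simp only [ite_smul, zero_smul]
      rw [← Finset.sum_filter, Finset.filter_mem_eq_inter]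
      symm
      refine Finset.sum_subset Finset.inter_subset_right fun i hi hi' => ?_
      have : ¬ i < m := fun hlt => hi' (Finset.mem_inter.2 ⟨Finset.mem_range.2 hlt, hi⟩)
      rw [dif_neg this, smul_zero]
    rw [e1]
    refine (hup _).trans (Real.sqrt_le_sqrt ?_)
    have := Fin.sum_univ_eq_sum_range (fun i : ℕ => ‖if i ∈ s then a i else 0‖ ^ 2) m
    rw [this]
    have e2 : ∀ i, ‖if i ∈ s then a i else 0‖ ^ 2 = if i ∈ s then ‖a i‖ ^ 2 else 0 := by
      intro i; split_ifs <;> simp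
    simp only [e2]
    rw [← Finset.sum_filter, Finset.filter_mem_eq_inter]
    exact Finset.sum_le_sum_of_subset_of_nonneg Finset.inter_subset_right
      fun _ _ _ => sq_nonneg _

/-- The weight attained by a chain that is prolonged with steps `δ (2 k + 2) ^ (-3 / 4)`. -/
def chainWeight (A δ : ℝ) (d j : ℕ) : ℝ :=
  A * ∏ k ∈ Finset.range (j - d), ((2 * k + 2 : ℝ) ^ (3 / 4 : ℝ) / δ)

lemma one_le_chainStep {δ : ℝ} (hδ : 0 < δ) (hδ1 : δ ≤ 1) (k : ℕ) :
    1 ≤ (2 * k + 2 : ℝ) ^ (3 / 4 : ℝ) / δ := by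
  rw [le_div_iff₀ hδ, one_mul]
  refine hδ1.trans (Real.one_le_rpow ?_ (by norm_num))
  have : (0 : ℝ) ≤ k := Nat.cast_nonneg k
  linarith

/-- Ratio test: a step of order `j ^ (3 / 4)` against the factor `j + 2` from the factorial leaves
`j ^ (-1 / 4) → 0`. -/
lemma isChainWeight_chainWeight {A δ : ℝ} (hA : 0 ≤ A) (hδ : 0 < δ) (hδ1 : δ ≤ 1) (d : ℕ) :
    IsChainWeight (chainWeight A δ d) := by
  have hnn : ∀ j, 0 ≤ chainWeight A δ d j := fun j =>
    mul_nonneg hA (Finset.prod_nonneg fun k _ => zero_le_one.trans (one_le_chainStep hδ hδ1 k))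
  refine ⟨hnn, fun i j hij => ?_, fun b hb => ?_⟩
  · refine mul_le_mul_of_nonneg_left ?_ hA
    exact Finset.prod_mono_set_of_one_le (one_le_chainStep hδ hδ1)
      (Finset.range_mono (Nat.sub_le_sub_right hij d))
  · refine summable_of_ratio_norm_eventually_le (r := 1 / 2) (by norm_num) ?_
    have ht : Tendsto (fun j : ℕ => 2 * b / δ * ((j : ℝ) + 2) ^ (-(1 / 4) : ℝ)) atTop (𝓝 0) := by
      have h1 : Tendsto (fun j : ℕ => (j : ℝ) + 2) atTop atTop :=
        tendsto_atTop_add_const_right _ _ tendsto_natCast_atTop_atTop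
      simpa only [mul_zero, Function.comp_def] using
        ((tendsto_rpow_neg_atTop (by norm_num : (0 : ℝ) < 1 / 4)).comp h1).const_mul (2 * b / δ)
    filter_upwards [ht.eventually (gt_mem_nhds (by norm_num : (0 : ℝ) < 1 / 2)),
      eventually_ge_atTop d] with j hj hjd
    have e : j + 1 - d = (j - d) + 1 := by omega
    have hstep : chainWeight A δ d (j + 1) =
        chainWeight A δ d j * ((2 * (j - d : ℕ) + 2 : ℝ) ^ (3 / 4 : ℝ) / δ) := by
      rw [chainWeight, e, Finset.prod_range_succ, ← mul_assoc, chainWeight]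
    have hle : (2 * (j - d : ℕ) + 2 : ℝ) ^ (3 / 4 : ℝ) ≤
        2 * ((j : ℝ) + 2) * ((j : ℝ) + 2) ^ (-(1 / 4) : ℝ) := by
      have h1 : (2 * (j - d : ℕ) + 2 : ℝ) ≤ 2 * ((j : ℝ) + 2) := by
        have : ((j - d : ℕ) : ℝ) ≤ j := by exact_mod_cast Nat.sub_le j d
        linarith
      have hj2 : (0 : ℝ) < (j : ℝ) + 2 := by positivity
      refine (Real.rpow_le_rpow (by positivity) h1 (by norm_num)).trans ?_
      rw [Real.mul_rpow (by norm_num) hj2.le, mul_assoc]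
      have h2 : ((j : ℝ) + 2) * ((j : ℝ) + 2) ^ (-(1 / 4) : ℝ) = ((j : ℝ) + 2) ^ (3 / 4 : ℝ) := by
        nth_rewrite 1 [← Real.rpow_one ((j : ℝ) + 2)]
        rw [← Real.rpow_add hj2]
        norm_num
      rw [h2]
      refine mul_le_mul_of_nonneg_right ?_ (by positivity)
      calc (2 : ℝ) ^ (3 / 4 : ℝ) ≤ 2 ^ (1 : ℝ) :=
            Real.rpow_le_rpow_of_exponent_le (by norm_num) (by norm_num)
        _ = 2 := Real.rpow_one 2
    rw [Real.norm_of_nonneg (mul_nonneg (by positivity) (hnn _)),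
      Real.norm_of_nonneg (mul_nonneg (by positivity) (hnn _)), hstep, pow_succ,
      Nat.factorial_succ (j + 1)]
    have hfac : (0 : ℝ) < (j + 1).factorial := by exact_mod_cast Nat.factorial_pos _
    have hj2 : (0 : ℝ) < (j : ℝ) + 2 := by positivity
    have key : b / ((j : ℝ) + 2) * ((2 * (j - d : ℕ) + 2 : ℝ) ^ (3 / 4 : ℝ) / δ) ≤ 1 / 2 := by
      refine le_trans ?_ hj.le
      calc b / ((j : ℝ) + 2) * ((2 * (j - d : ℕ) + 2 : ℝ) ^ (3 / 4 : ℝ) / δ)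
          ≤ b / ((j : ℝ) + 2) * (2 * ((j : ℝ) + 2) * ((j : ℝ) + 2) ^ (-(1 / 4) : ℝ) / δ) := by
            gcongr
        _ = 2 * b / δ * ((j : ℝ) + 2) ^ (-(1 / 4) : ℝ) := by field_simp
    calc b ^ j * b / (((j + 1 + 1 : ℕ) * (j + 1).factorial : ℕ) : ℝ) *
          (chainWeight A δ d j * ((2 * (j - d : ℕ) + 2 : ℝ) ^ (3 / 4 : ℝ) / δ))
        = (b / ((j : ℝ) + 2) * ((2 * (j - d : ℕ) + 2 : ℝ) ^ (3 / 4 : ℝ) / δ)) *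
          (b ^ j / (j + 1).factorial * chainWeight A δ d j) := by
          push_cast
          rw [show (j : ℝ) + 1 + 1 = j + 2 by ring]
          field_simp
      _ ≤ 1 / 2 * (b ^ j / (j + 1).factorial * chainWeight A δ d j) :=
          mul_le_mul_of_nonneg_right key (mul_nonneg (by positivity) (hnn _))

end Perturbation

section Perturbation

variable {𝕜 X : Type*} [RCLike 𝕜] [NormedAddCommGroup X] [NormedSpace 𝕜 X]

lemma summable_rpow_sq : Summable fun i : ℕ => (((i : ℝ) + 1) ^ (-(3 / 4) : ℝ)) ^ 2 := by
  have h := (summable_nat_add_iff 1).2 (Real.summable_nat_rpow.2 (by norm_num : (-(3 / 2) : ℝ) < -1))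
  refine h.congr fun i => ?_
  rw [← Real.rpow_natCast (_ ^ _) 2, ← Real.rpow_mul (by positivity)]
  push_cast
  norm_num

set_option maxHeartbeats 1000000 in
/-- A finite rank nilpotent operator can be perturbed so that two given vectors lie on long Jordan
chains whose norms obey a chain weight that does not depend on their length. -/
theorem exists_chain_perturbation (hX : ¬ FiniteDimensional 𝕜 X) {N : X →L[𝕜] X}
    (hN : N ∈ finiteRankNilpotent 𝕜 X) (x v : X) {ε : ℝ} (hε : 0 < ε) :
    ∃ (d : ℕ) (W : ℕ → ℝ), IsChainWeight W ∧ ∀ m : ℕ, ∃ K ∈ finiteRankNilpotent 𝕜 X, ‖K - N‖ < ε ∧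
      ∃ (f g : ℕ → X) (φ : X →L[𝕜] 𝕜), IsJordanChain K f (d + m + 1) ∧
        IsJordanChain K g (d + m + 1) ∧ f d = x ∧ g d = v ∧
        (∀ j ≤ d + m + 1, ‖f j‖ ≤ W j) ∧ (∀ j ≤ d + m + 1, ‖g j‖ ≤ W j) ∧
        φ (f (d + 1)) = 1 ∧ ∀ j ≤ d + m + 1, j ≠ d + 1 → φ (f j) = 0 := by
  obtain ⟨⟨d, hd⟩, F, hF, hNF⟩ := hN
  set G : Submodule 𝕜 X := F ⊔ Submodule.span 𝕜 {x, v} with hG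
  have : FiniteDimensional 𝕜 (Submodule.span 𝕜 ({x, v} : Set X)) :=
    FiniteDimensional.span_of_finite 𝕜 (by simp)
  have hNG : ∀ y, N y ∈ G := fun y => Submodule.mem_sup_left (hNF y)
  have hxG : x ∈ G := Submodule.mem_sup_right (Submodule.subset_span (by simp))
  have hvG : v ∈ G := Submodule.mem_sup_right (Submodule.subset_span (by simp))
  obtain ⟨C, hC, hsys⟩ := exists_biorthogonal_in_kernel hX N G hNG
  set u : ℕ → ℝ := fun i => ((i : ℝ) + 1) ^ (-(3 / 4) : ℝ) with hu
  have hu0 (i) : 0 < u i := Real.rpow_pos_of_pos (by positivity) _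
  have hu1 (i) : u i ≤ 1 := Real.rpow_le_one_of_one_le_of_nonpos
    (by have : (0 : ℝ) ≤ i := Nat.cast_nonneg i
        linarith) (by norm_num)
  set S : ℝ := ∑' i, u i ^ 2 with hS
  set B : ℝ := C * (‖x‖ + ‖v‖ + √S) with hB
  have hB0 : 0 ≤ B := by positivity
  -- `B * δ` will bound the norm of the perturbation; `B` collects the two steps onto `x` and `v`
  -- and the ℓ² estimate for all the others.
  set δ : ℝ := min 1 (ε / (B + 1)) with hδ
  have hδ0 : 0 < δ := lt_min one_pos (by positivity)
  have hδ1 : δ ≤ 1 := min_le_left _ _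
  have hδε : B * δ < ε := by
    have h1 : δ ≤ ε / (B + 1) := min_le_right _ _
    rw [le_div_iff₀ (by positivity)] at h1
    nlinarith
  set w : ℕ → ℝ := fun i => δ * u i with hw
  have hw0 (i) : 0 < w i := mul_pos hδ0 (hu0 i)
  have hwδ (i) : w i ≤ δ := mul_le_of_le_one_right hδ0.le (hu1 i)
  set A : ℝ := 1 + ∑ k ∈ Finset.range (d + 1), (‖(N ^ k) x‖ + ‖(N ^ k) v‖) with hA
  have hA1 : 1 ≤ A := le_add_of_nonneg_right (Finset.sum_nonneg fun _ _ => by positivity)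
  refine ⟨d, chainWeight A δ d, isChainWeight_chainWeight (by linarith) hδ0 hδ1 d, fun m => ?_⟩
  obtain ⟨h, ψ, hNh, hψG, hψh, hψC, hup⟩ := hsys (2 * m + 2)
  have hh1 (i) : ‖h i‖ ≤ 1 := by simpa using hup (fun _ => 1) {i}
  -- Two interleaved chains: the perturbation sends `h i = e (i + 2)` to `w i • e i`, so even
  -- indices prolong the chain above `x` and odd ones the chain above `v`.
  let e : ℕ → X := fun i => match i with
    | 0 => x
    | 1 => v
    | i + 2 => h i
  set R : X →L[𝕜] X := ∑ i ∈ Finset.range (2 * m + 2), (ψ i).smulRight ((w i : 𝕜) • e i) with hR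
  have hRapp (y : X) : R y = ∑ i ∈ Finset.range (2 * m + 2), ψ i y • ((w i : 𝕜) • e i) := by
    simp [hR]
  have hRG (y : X) (hy : y ∈ G) : R y = 0 := by
    rw [hRapp]
    exact Finset.sum_eq_zero fun i _ => by rw [hψG i y hy, zero_smul]
  have hRh (i : ℕ) (hi : i < 2 * m + 2) : R (h i) = (w i : 𝕜) • e i := by
    rw [hRapp, Finset.sum_eq_single i]
    · rw [hψh i hi i hi, if_pos rfl, one_smul]
    · intro j hj hji
      rw [hψh j (Finset.mem_range.1 hj) i hi, if_neg hji, zero_smul]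
    · intro hi'
      exact absurd (Finset.mem_range.2 hi) hi'
  have hRnorm : ‖R‖ ≤ B * δ := by
    refine ContinuousLinearMap.opNorm_le_bound _ (by positivity) fun y => ?_
    have hψy (i) : ‖ψ i y‖ ≤ C * ‖y‖ := (ψ i).le_of_opNorm_le (hψC i) y
    have hterm (i) (z : X) : ‖ψ i y • ((w i : 𝕜) • z)‖ ≤ C * ‖y‖ * (δ * ‖z‖) := by
      rw [norm_smul, norm_smul, RCLike.norm_ofReal, abs_of_pos (hw0 i)]
      gcongr
      · exact hψy i
      · exact hwδ i
    have hsum : ‖∑ i ∈ Finset.range (2 * m), (ψ (i + 2) y * (w (i + 2) : 𝕜)) • h i‖ ≤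
        C * ‖y‖ * (δ * √S) := by
      refine (hup (fun i => ψ (i + 2) y * (w (i + 2) : 𝕜)) _).trans ?_
      refine Real.sqrt_le_iff.2 ⟨by positivity, ?_⟩
      rw [mul_pow, mul_pow δ, Real.sq_sqrt (tsum_nonneg fun _ => sq_nonneg _)]
      have hle : ∀ i ∈ Finset.range (2 * m), ‖ψ (i + 2) y * (w (i + 2) : 𝕜)‖ ^ 2 ≤
          (C * ‖y‖) ^ 2 * (δ ^ 2 * u (i + 2) ^ 2) := by
        intro i _
        rw [norm_mul, RCLike.norm_ofReal, abs_of_pos (hw0 _), mul_pow, hw, mul_pow]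
        gcongr
        exact hψy _
      refine (Finset.sum_le_sum hle).trans ?_
      rw [← Finset.mul_sum, ← Finset.mul_sum]
      gcongr
      refine (((summable_nat_add_iff 2).2 summable_rpow_sq).sum_le_tsum _
        fun _ _ => sq_nonneg _).trans ?_
      rw [← (summable_rpow_sq).sum_add_tsum_nat_add 2]
      exact le_add_of_nonneg_left (Finset.sum_nonneg fun _ _ => sq_nonneg _)
    rw [hRapp, Finset.sum_range_succ', Finset.sum_range_succ']
    simp only [e, smul_smul] at hsum ⊢
    have h0 := hterm 0 x
    have h1 := hterm 1 v
    rw [smul_smul] at h0 h1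
    refine (norm_add_le _ _).trans ?_
    refine (add_le_add (norm_add_le _ _) h0).trans ?_
    refine (add_le_add (add_le_add hsum h1) le_rfl).trans (le_of_eq ?_)
    rw [hB]; ring
  set K : X →L[𝕜] X := N + R with hK
  have hKG (y : X) (hy : y ∈ G) : K y = N y := by simp [hK, hRG y hy]
  have hKe (i : ℕ) (hi : i < 2 * m + 2) : K (e (i + 2)) = (w i : 𝕜) • e i := by
    simp only [hK, add_apply, e]
    rw [hNh, hRh i hi, zero_add]
  -- Up to position `d` the chain consists of the `N`-iterates of `x` or `v`, starting from `N ^ d =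
  -- 0`. Above `d` it follows `e`, rescaled to absorb the steps `w`.
  let c : ℕ → ℕ → X := fun p j => if j ≤ d then (N ^ (d - j)) (e p) else
    ((∏ k ∈ Finset.range (j - d), w (2 * k + p) : ℝ) : 𝕜)⁻¹ • e (2 * (j - d) + p)
  have hctop (p i : ℕ) : c p (d + i) =
      ((∏ k ∈ Finset.range i, w (2 * k + p) : ℝ) : 𝕜)⁻¹ • e (2 * i + p) := by
    rcases Nat.eq_zero_or_pos i with rfl | hi
    · simp [c]
    · simp only [c]
      rw [if_neg (by omega), Nat.add_sub_cancel_left]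
  have hcbot (p i : ℕ) (hi : i ≤ d) : c p i = (N ^ (d - i)) (e p) := by
    simp only [c]; rw [if_pos hi]
  have hepG (p : ℕ) (hp : p < 2) : e p ∈ G := by
    interval_cases p
    · exact hxG
    · exact hvG
  have hpowG (p : ℕ) (hp : p < 2) (k : ℕ) : (N ^ k) (e p) ∈ G := by
    cases k with
    | zero => simpa using hepG p hp
    | succ k => rw [pow_succ', mul_apply_eq_comp]; exact hNG _
  have hchain (p : ℕ) (hp : p < 2) : IsJordanChain K (c p) (d + m + 1) := by
    refine ⟨?_, fun j hj => ?_⟩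
    · rw [hcbot p 0 (Nat.zero_le d), Nat.sub_zero, hd]; simp
    · rcases Nat.lt_or_ge j d with hjd | hjd
      · rw [hcbot p _ hjd, hcbot p _ hjd.le, hKG _ (hpowG p hp _), ← mul_apply_eq_comp, ← pow_succ']
        congr 2
        omega
      · obtain ⟨i, rfl⟩ := Nat.exists_eq_add_of_le hjd
        rw [add_assoc, hctop, hctop, map_smul, show 2 * (i + 1) + p = 2 * i + p + 2 by ring,
          hKe _ (by omega), smul_smul, Finset.prod_range_succ]
        congr 1
        have h1 : (w (2 * i + p) : 𝕜) ≠ 0 := RCLike.ofReal_ne_zero.2 (hw0 _).ne'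
        rw [RCLike.ofReal_mul, mul_inv, mul_assoc, inv_mul_cancel₀ h1, mul_one]
  have hnorm (p : ℕ) (hp : p < 2) (j : ℕ) : ‖c p j‖ ≤ chainWeight A δ d j := by
    rcases Nat.lt_or_ge d j with hjd | hjd
    · obtain ⟨i, rfl⟩ := Nat.exists_eq_add_of_le hjd.le
      obtain ⟨i, rfl⟩ : ∃ l, i = l + 1 := ⟨i - 1, by omega⟩
      rw [hctop, chainWeight, Nat.add_sub_cancel_left, norm_smul, norm_inv, RCLike.norm_ofReal,
        Finset.abs_prod, ← Finset.prod_inv_distrib, mul_comm]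
      have he : ‖e (2 * (i + 1) + p)‖ ≤ A := (hh1 (2 * i + p)).trans hA1 |> fun h => by
        rw [show 2 * (i + 1) + p = 2 * i + p + 2 by ring]; exact h
      refine mul_le_mul he (Finset.prod_le_prod (fun k _ => by positivity) fun k _ => ?_)
        (Finset.prod_nonneg fun k _ => by positivity) (by linarith)
      rw [abs_of_pos (hw0 _), hw]
      simp only [hu]
      rw [mul_inv, ← Real.rpow_neg (by positivity), neg_neg, mul_comm, div_eq_mul_inv]
      refine mul_le_mul_of_nonneg_right (Real.rpow_le_rpow (by positivity) ?_ (by norm_num))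
        (inv_pos.2 hδ0).le
      -- The inverse step at `2 * k + p` involves `2 * k + p + 1 ≤ 2 * k + 2`, so one weight serves
      -- both chains.
      have : (p : ℝ) ≤ 1 := by exact_mod_cast Nat.lt_succ_iff.1 hp
      push_cast
      linarith
    · rw [hcbot p j hjd, chainWeight, Nat.sub_eq_zero_of_le hjd, Finset.prod_range_zero, mul_one]
      have h1 := Finset.single_le_sum (f := fun k => ‖(N ^ k) x‖ + ‖(N ^ k) v‖)
        (fun k _ => by positivity) (Finset.mem_range.2 (by omega : d - j < d + 1))
      have h2 := norm_nonneg ((N ^ (d - j)) x)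
      have h3 := norm_nonneg ((N ^ (d - j)) v)
      interval_cases p <;> simp only [e] <;> linarith
  have hKnil : IsNilpotent K := by
    refine ⟨d + m + 2 + 1, ?_⟩
    ext y
    have hKN (k : ℕ) (y : X) (hy : y ∈ G) : (K ^ k) y = (N ^ k) y := by
      induction k generalizing y with
      | zero => rfl
      | succ k ih =>
        rw [pow_succ, mul_apply_eq_comp, hKG y hy, ih _ (hNG y), pow_succ, mul_apply_eq_comp]
    -- `e i` is a nonzero multiple of the vector at position `d + i / 2` of the chain with parity `i
    -- % 2`.
    have he (i : ℕ) (hi : i < 2 * m + 4) : (K ^ (d + m + 2)) (e i) = 0 := by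
      have hp : i % 2 < 2 := Nat.mod_lt _ two_pos
      have h1 := (hchain _ hp).pow_apply_eq_zero (d + m + 2) (d + i / 2) (by omega) (by omega)
      rw [hctop, Nat.div_add_mod, map_smul] at h1
      refine (smul_eq_zero.1 h1).resolve_left (inv_ne_zero (RCLike.ofReal_ne_zero.2 ?_))
      exact Finset.prod_ne_zero_iff.2 fun k _ => (hw0 _).ne'
    rw [pow_succ, mul_apply_eq_comp, hK, add_apply, ← hK, map_add, hKN _ _ (hNG y), hRapp, map_sum,
      Finset.sum_eq_zero fun i hi => by
        rw [map_smul, map_smul, he i (by have := Finset.mem_range.1 hi; omega), smul_zero, smul_zero],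
      show d + m + 2 = m + 2 + d by ring, pow_add, hd]
    simp
  have hKfin : ∃ F : Submodule 𝕜 X, FiniteDimensional 𝕜 F ∧ ∀ x, K x ∈ F := by
    have : FiniteDimensional 𝕜
        (Submodule.span 𝕜 (e '' Set.Iio (2 * m + 2))) :=
      FiniteDimensional.span_of_finite 𝕜 ((Set.finite_Iio _).image e)
    refine ⟨F ⊔ Submodule.span 𝕜 (e '' Set.Iio (2 * m + 2)), inferInstance, fun y => ?_⟩
    refine Submodule.add_mem_sup (hNF y) ?_
    change R y ∈ _
    rw [hRapp]
    refine Submodule.sum_mem _ fun i hi => Submodule.smul_mem _ _ (Submodule.smul_mem _ _ ?_)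
    exact Submodule.subset_span ⟨i, Finset.mem_range.1 hi, rfl⟩
  refine ⟨K, ⟨hKnil, hKfin⟩, ?_, c 0, c 1, (w 0 : 𝕜) • ψ 0, hchain 0 (by norm_num),
    hchain 1 (by norm_num), ?_, ?_, fun j _ => hnorm 0 (by norm_num) j,
    fun j _ => hnorm 1 (by norm_num) j, ?_, fun j hj hjd => ?_⟩
  · rw [hK, add_sub_cancel_left]; exact hRnorm.trans_lt hδε
  · rw [hcbot 0 d le_rfl]; simp [e]
  · rw [hcbot 1 d le_rfl]; simp [e]
  · rw [hctop 0 1]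
    simp only [Finset.prod_range_one, mul_zero, mul_one, add_zero, e, smul_apply, map_smul,
      smul_eq_mul]
    rw [hψh 0 (by omega) 0 (by omega), if_pos rfl, mul_one, inv_mul_cancel₀]
    exact RCLike.ofReal_ne_zero.2 (hw0 _).ne'
  · rw [smul_apply]
    rcases Nat.lt_or_ge d j with hdj | hdj
    · obtain ⟨i, rfl⟩ : ∃ l, j = d + (l + 2) := ⟨j - d - 2, by omega⟩
      rw [hctop 0 (i + 2), show 2 * (i + 2) + 0 = 2 * i + 2 + 2 by ring, map_smul]
      simp only [e]
      rw [hψh 0 (by omega) (2 * i + 2) (by omega), if_neg (by omega)]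
      simp
    · rw [hcbot 0 j hdj, hψG 0 _ (hpowG 0 (by norm_num) _), smul_zero]

end Perturbation

/-! ### Density of each requirement among finite rank nilpotents -/

section Density

variable {𝕜 X : Type*} [RCLike 𝕜] [NormedAddCommGroup X] [NormedSpace 𝕜 X]

lemma orbitMean_nonneg (T : X →L[𝕜] X) (x : X) (n : ℕ) : 0 ≤ orbitMean T x n :=
  mul_nonneg (by positivity) (Finset.sum_nonneg fun _ _ => norm_nonneg _)

lemma norm_pow_apply_le_orbitMean (T : X →L[𝕜] X) (x : X) {n : ℕ} (hn : 1 ≤ n) :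
    ‖(T ^ n) x‖ ≤ n * orbitMean T x n := by
  have hn0 : (n : ℝ) ≠ 0 := by positivity
  rw [orbitMean, ← mul_assoc, mul_one_div_cancel hn0, one_mul]
  exact Finset.single_le_sum (f := fun i => ‖(T ^ i) x‖) (fun _ _ => norm_nonneg _)
    (Finset.mem_Icc.2 ⟨hn, le_rfl⟩)

lemma orbitMean_le (T : X →L[𝕜] X) (x : X) {n n₀ : ℕ} (hn : 1 ≤ n) {C ε : ℝ} (hC : 0 ≤ C)
    (hε : 0 ≤ ε) (h1 : ∀ i ≤ n, ‖(T ^ i) x‖ ≤ C) (h2 : ∀ i ≤ n, n₀ ≤ i → ‖(T ^ i) x‖ ≤ ε) :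
    orbitMean T x n ≤ ε + n₀ * C / n := by
  have hn0 : (0 : ℝ) < n := by positivity
  rw [orbitMean, one_div, inv_mul_le_iff₀ hn0, mul_add, mul_div_cancel₀ _ hn0.ne']
  have hle : ∀ i ∈ Finset.Icc 1 n, ‖(T ^ i) x‖ ≤ ε + if i < n₀ then C else 0 := by
    intro i hi
    have hin := (Finset.mem_Icc.1 hi).2
    split_ifs with h
    · linarith [h1 i hin]
    · linarith [h2 i hin (not_lt.1 h)]
  refine (Finset.sum_le_sum hle).trans ?_
  rw [Finset.sum_add_distrib, ← Finset.sum_filter, Finset.sum_const, Finset.sum_const,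
    nsmul_eq_mul, nsmul_eq_mul, Nat.card_Icc, Nat.add_sub_cancel]
  gcongr
  have : (Finset.Icc 1 n).filter (· < n₀) ⊆ Finset.range n₀ := fun i hi =>
    Finset.mem_range.2 (Finset.mem_filter.1 hi).2
  simpa using Finset.card_le_card this

variable [CompleteSpace X]

lemma exp_mul_exp_neg (K : X →L[𝕜] X) : NormedSpace.exp K * NormedSpace.exp (-K) = 1 := by
  let _ : NormedAlgebra ℚ (X →L[𝕜] X) := NormedAlgebra.restrictScalars ℚ 𝕜 (X →L[𝕜] X)
  rw [← NormedSpace.exp_add_of_commute (Commute.neg_right (Commute.refl K)), add_neg_cancel,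
    NormedSpace.exp_zero]

lemma exp_pow_mul_exp_neg_pow (K : X →L[𝕜] X) (n : ℕ) :
    NormedSpace.exp K ^ n * NormedSpace.exp (-K) ^ n = 1 := by
  have hc : Commute (NormedSpace.exp K) (NormedSpace.exp (-K)) :=
    ((Commute.refl K).neg_right).exp
  rw [← hc.mul_pow, exp_mul_exp_neg, one_pow]

/-- `C` and `n₀` are fixed before `n`, so `n` can be taken so large that the first `n₀` terms do not
affect the mean; the chain is then made long enough for this `n`. -/
theorem exists_near_orbitMean_lt (hX : ¬ FiniteDimensional 𝕜 X) {N : X →L[𝕜] X}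
    (hN : N ∈ finiteRankNilpotent 𝕜 X) (x : X) {ε : ℝ} (hε : 0 < ε) (k : ℕ) :
    ∃ K ∈ finiteRankNilpotent 𝕜 X, ∃ x' : X, ‖K - N‖ < ε ∧ ‖x' - x‖ < ε ∧
      ∃ n > k, orbitMean (NormedSpace.exp K) x' n < ε := by
  obtain ⟨d, W, hW, hF⟩ := exists_chain_perturbation hX hN x x hε
  obtain ⟨C, n₀, hdec⟩ := exists_decaying_orbit d hW (half_pos hε) 𝕜 X
  obtain ⟨n, hn⟩ := exists_nat_gt (max (k : ℝ) (n₀ * |C| / (ε / 2)))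
  have hnk : k < n := by exact_mod_cast (le_max_left _ _).trans_lt hn
  have hn0 : (0 : ℝ) < n := by exact_mod_cast (Nat.zero_le k).trans_lt hnk
  have hnC : n₀ * |C| / n < ε / 2 := by
    have := (le_max_right _ _).trans_lt hn
    rw [div_lt_iff₀ (half_pos hε)] at this
    rw [div_lt_iff₀ hn0]
    linarith
  obtain ⟨D₀, hD₀⟩ := hdec n
  obtain ⟨K, hK, hKN, f, g, φ, hf, -, hfd, -, hfW, -⟩ := hF D₀
  obtain ⟨y, hy1, hy2, hy3⟩ := hD₀ _ (by omega) K f hf hfW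
  rw [hfd] at hy1
  refine ⟨K, hK, y, hKN, by linarith, n, hnk, ?_⟩
  have := orbitMean_le (NormedSpace.exp K) y (n := n) (by omega) (abs_nonneg C)
    (half_pos hε).le (fun i hi => (hy2 i hi).trans (le_abs_self C)) hy3
  linarith

/-- Take `y` near `x` with `exp K ^ n y` small, and `z` near `±v` with `exp (-K) ^ n z` small. Then
`y ± exp (-K) ^ n z` is near `x` and is sent near `v`. The sign comes from turning the chain of `K`
into one of `-K`. -/
theorem exists_near_orbit_hitting (hX : ¬ FiniteDimensional 𝕜 X) {N : X →L[𝕜] X}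
    (hN : N ∈ finiteRankNilpotent 𝕜 X) (x v : X) {ε : ℝ} (hε : 0 < ε) :
    ∃ K ∈ finiteRankNilpotent 𝕜 X, ∃ x' : X, ‖K - N‖ < ε ∧ ‖x' - x‖ < ε ∧
      ∃ n : ℕ, ‖(NormedSpace.exp K ^ n) x' - v‖ < ε := by
  obtain ⟨d, W, hW, hF⟩ := exists_chain_perturbation hX hN x v hε
  obtain ⟨C, n, hdec⟩ := exists_decaying_orbit d hW (by positivity : 0 < ε / 4) 𝕜 X
  obtain ⟨D₀, hD₀⟩ := hdec n
  obtain ⟨K, hK, hKN, f, g, φ, hf, hg, hfd, hgd, hfW, hgW, -⟩ := hF D₀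
  obtain ⟨y, hy1, -, hy3⟩ := hD₀ _ (by omega) K f hf hfW
  obtain ⟨z, hz1, -, hz3⟩ := hD₀ _ (by omega) (-K) _ hg.neg fun j hj => by
    rw [norm_smul, norm_pow, norm_neg, norm_one, one_pow, one_mul]; exact hgW j hj
  have hy := hy3 n le_rfl le_rfl
  have hz := hz3 n le_rfl le_rfl
  rw [hfd] at hy1
  rw [hgd] at hz1
  have hsign : ((-1 : 𝕜) ^ d) * (-1) ^ d = 1 := by rw [← mul_pow]; simp
  have hnorm (w : X) : ‖(-1 : 𝕜) ^ d • w‖ = ‖w‖ := by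
    rw [norm_smul, norm_pow, norm_neg, norm_one, one_pow, one_mul]
  refine ⟨K, hK, y + (-1 : 𝕜) ^ d • (NormedSpace.exp (-K) ^ n) z, hKN, ?_, n, ?_⟩
  · rw [add_sub_right_comm]
    refine (norm_add_le _ _).trans_lt ?_
    rw [hnorm]
    linarith
  · have e : (NormedSpace.exp K ^ n) (y + (-1 : 𝕜) ^ d • (NormedSpace.exp (-K) ^ n) z) - v =
        (NormedSpace.exp K ^ n) y + (-1 : 𝕜) ^ d • (z - (-1 : 𝕜) ^ d • v) := by
      rw [map_add, map_smul, ← mul_apply_eq_comp, exp_pow_mul_exp_neg_pow, smul_sub, smul_smul,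
        hsign, one_smul, one_apply_eq_self, add_sub_assoc]
    rw [e]
    refine (norm_add_le _ _).trans_lt ?_
    rw [hnorm]
    linarith

/-- A small multiple of a chain vector two places above `d + 1` grows at least like `n ^ 2` along
the orbit, as `φ` detects. The mean is at least `‖T ^ n ·‖ / n`, so quadratic growth beats any
constant. -/
theorem exists_near_orbitMean_gt (hX : ¬ FiniteDimensional 𝕜 X) {N : X →L[𝕜] X}
    (hN : N ∈ finiteRankNilpotent 𝕜 X) (x : X) {ε : ℝ} (hε : 0 < ε) (k l : ℕ) (c : ℝ) :
    ∃ K ∈ finiteRankNilpotent 𝕜 X, ∃ x' : X, ‖K - N‖ < ε ∧ ‖x' - x‖ < ε ∧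
      ∃ n > l, c < orbitMean (NormedSpace.exp K) ((K ^ k) x') n := by
  obtain ⟨d, W, -, hF⟩ := exists_chain_perturbation hX hN x x hε
  obtain ⟨K, hK, hKN, f, -, φ, hf, -, -, -, -, -, hφ1, hφ0⟩ := hF (k + 2)
  set δ : ℝ := ε / (‖f (d + 3 + k)‖ + 1) with hδ
  have hδ0 : 0 < δ := by positivity
  -- Placed `k` positions higher, so that `K ^ k` brings it back to position `d + 3`.
  set u : X := (δ : 𝕜) • f (d + 3 + k) with hu
  have huε : ‖u‖ < ε := by
    rw [hu, norm_smul, RCLike.norm_ofReal, abs_of_pos hδ0, hδ, div_mul_eq_mul_div,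
      div_lt_iff₀ (by positivity)]
    nlinarith [norm_nonneg (f (d + 3 + k))]
  obtain ⟨n, hn⟩ := exists_nat_gt (max (l : ℝ) (2 * (|c| * (‖φ‖ + 1)) / δ))
  have hnl : l < n := by exact_mod_cast (le_max_left _ _).trans_lt hn
  have hn0 : (0 : ℝ) < n := by exact_mod_cast (Nat.zero_le l).trans_lt hnl
  have hnc : 2 * (|c| * (‖φ‖ + 1)) < n * δ := by
    have := (le_max_right _ _).trans_lt hn
    rwa [div_lt_iff₀ hδ0] at this
  set T := NormedSpace.exp K with hT
  have hφT : φ ((T ^ n) ((K ^ k) u)) = ((δ * ((n : ℝ) ^ 2 / 2) : ℝ) : 𝕜) := by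
    rw [hu, map_smul, hf.pow_apply k (d + 3) (by omega), map_smul, map_smul, hT,
      hf.exp_pow_apply n (d + 3) (by omega), map_sum, Finset.sum_eq_single (d + 1)]
    · rw [map_smul, hφ1, smul_eq_mul, smul_eq_mul, mul_one, ← RCLike.ofReal_mul,
        show d + 3 - (d + 1) = 2 by omega]
      norm_num
    · intro i hi hid
      rw [map_smul, hφ0 i (by have := Finset.mem_range.1 hi; omega) hid, smul_zero]
    · intro h
      exact absurd (Finset.mem_range.2 (by omega)) h
  have hlow : δ * ((n : ℝ) ^ 2 / 2) ≤ (‖φ‖ + 1) * ‖(T ^ n) ((K ^ k) u)‖ := by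
    have h1 := φ.le_opNorm ((T ^ n) ((K ^ k) u))
    rw [hφT, RCLike.norm_ofReal, abs_of_nonneg (by positivity)] at h1
    nlinarith [norm_nonneg ((T ^ n) ((K ^ k) u))]
  have hbig : n * |c| < ‖(T ^ n) ((K ^ k) u)‖ := by
    have h1 : (‖φ‖ + 1) * (n * |c|) < (‖φ‖ + 1) * ‖(T ^ n) ((K ^ k) u)‖ := by
      refine lt_of_lt_of_le ?_ hlow
      have := mul_lt_mul_of_pos_right hnc hn0
      nlinarith
    exact lt_of_mul_lt_mul_left h1 (by positivity)
  -- If both `x + u` and `x - u` had small means, their difference would bound the large vector `2 •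
  -- T ^ n (K ^ k u)`.
  by_contra! hcon
  have hmean (w : X) (hw : ‖w‖ < ε) : ‖(T ^ n) ((K ^ k) (x + w))‖ ≤ n * |c| := by
    refine (norm_pow_apply_le_orbitMean T _ (by omega)).trans ?_
    refine mul_le_mul_of_nonneg_left (le_trans ?_ (le_abs_self c)) hn0.le
    exact hcon K hK (x + w) hKN (by simpa using hw) n hnl
  have h1 := hmean u huε
  have h2 := hmean (-u) (by simpa using huε)
  have e : (2 : 𝕜) • (T ^ n) ((K ^ k) u) =
      (T ^ n) ((K ^ k) (x + u)) - (T ^ n) ((K ^ k) (x + -u)) := by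
    simp only [map_add, map_neg, two_smul]; abel
  have h3 := norm_sub_le ((T ^ n) ((K ^ k) (x + u))) ((T ^ n) ((K ^ k) (x + -u)))
  rw [← e, norm_smul, RCLike.norm_ofNat] at h3
  linarith

end Density

/-! ### From an irregular pair to manifolds and residual sets -/

section Generic

variable {𝕜 X : Type*} [RCLike 𝕜] [NormedAddCommGroup X] [NormedSpace 𝕜 X]

lemma isAbsolutelyMeanIrregular_of_frequently {T : X →L[𝕜] X} {x : X}
    (h0 : ∀ ε > 0, ∀ k : ℕ, ∃ n > k, orbitMean T x n < ε)
    (h1 : ∀ c : ℝ, ∀ k : ℕ, ∃ n > k, c < orbitMean T x n) : IsAbsolutelyMeanIrregular T x := by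
  constructor
  · refine le_antisymm ?_ ?_
    · refine EReal.le_of_forall_lt_iff_le.1 fun ε hε => ?_
      refine liminf_le_of_frequently_le' (frequently_atTop.2 fun k => ?_)
      obtain ⟨n, hn, hlt⟩ := h0 ε (by exact_mod_cast hε) k
      exact ⟨n, hn.le, by exact_mod_cast hlt.le⟩
    · refine le_liminf_of_le ?_ (Eventually.of_forall fun n => ?_)
      · isBoundedDefault
      · exact_mod_cast orbitMean_nonneg T x n
  · refine EReal.eq_top_iff_forall_lt _ |>.2 fun c => ?_
    refine lt_of_lt_of_le (b := ((c + 1 : ℝ) : EReal)) (by exact_mod_cast lt_add_one c) ?_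
    refine le_limsup_of_frequently_le' (frequently_atTop.2 fun k => ?_)
    obtain ⟨n, hn, hlt⟩ := h1 (c + 1) k
    exact ⟨n, hn.le, by exact_mod_cast hlt.le⟩

lemma orbitMean_map_le {T A : X →L[𝕜] X} (h : Commute A T) (x : X) (n : ℕ) :
    orbitMean T (A x) n ≤ ‖A‖ * orbitMean T x n := by
  rw [orbitMean, orbitMean, mul_left_comm, Finset.mul_sum _ _ ‖A‖]
  have h0 : (0 : ℝ) ≤ 1 / n := by positivity
  refine mul_le_mul_of_nonneg_left (Finset.sum_le_sum fun i _ => ?_) h0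
  rw [← mul_apply_eq_comp, ← (h.pow_right i).eq, mul_apply_eq_comp]
  exact A.le_opNorm _

/-- The requirements on `(K, x)` that make `exp K` hypercyclic with many absolutely mean irregular
vectors. -/
structure IsIrregularPair (K : X →L[𝕜] X) (x : X) : Prop where
  hypercyclic : IsHypercyclicVector (NormedSpace.exp K) x
  low : ∀ k : ℕ, ∃ n > k, orbitMean (NormedSpace.exp K) x n < 1 / (k + 1)
  high : ∀ k l : ℕ, ∃ n > l, (l : ℝ) < orbitMean (NormedSpace.exp K) ((K ^ k) x) n
  quasinilpotent : ∀ k : ℕ, ∃ n ≥ 1, ‖K ^ n‖ < (1 / (k + 1 : ℝ)) ^ n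

lemma commute_aeval_exp (K : X →L[𝕜] X) (q : Polynomial 𝕜) :
    Commute (Polynomial.aeval K q) (NormedSpace.exp K) := by
  refine Commute.exp_right ?_
  have := (Commute.all q Polynomial.X).map (Polynomial.aeval K)
  rwa [Polynomial.aeval_X] at this

/-- The vectors `q(K) x`, for `q` a polynomial. -/
def polynomialOrbit (K : X →L[𝕜] X) (x : X) : Submodule 𝕜 X :=
  LinearMap.range ((ContinuousLinearMap.apply 𝕜 X x : (X →L[𝕜] X) →ₗ[𝕜] X) ∘ₗ
    (Polynomial.aeval K).toLinearMap)

lemma mem_polynomialOrbit {K : X →L[𝕜] X} {x y : X} :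
    y ∈ polynomialOrbit K x ↔ ∃ q : Polynomial 𝕜, Polynomial.aeval K q x = y := Iff.rfl

lemma continuous_orbitMean (T : X →L[𝕜] X) (n : ℕ) : Continuous fun x => orbitMean T x n := by
  unfold orbitMean
  fun_prop

/-- Each mean is continuous in the vector, so irregularity amounts to countably many open
conditions; these hold on the dense set of nonzero vectors of the manifold. -/
lemma HasDenseAbsolutelyMeanIrregularManifold.hasResidual [Nontrivial X] {T : X →L[𝕜] X}
    (h : HasDenseAbsolutelyMeanIrregularManifold T) : HasResidualAbsolutelyMeanIrregular T := by
  obtain ⟨Y, hY, hYT⟩ := h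
  have hne : ∀ x : X, (𝓝[≠] x).NeBot := Module.punctured_nhds_neBot 𝕜 X
  have hY0 : Dense ((Y : Set X) \ {0}) := hY.sdiff_singleton 0
  have key (P : ℕ → ℝ → Prop) (hP : ∀ k, IsOpen {t | P k t})
      (h : ∀ x, IsAbsolutelyMeanIrregular T x → ∀ k, ∃ n > k, P k (orbitMean T x n)) :
      ∀ᶠ x in residual X, ∀ k, ∃ n > k, P k (orbitMean T x n) := by
    refine eventually_countable_forall.2 fun k => residual_of_dense_open ?_ ?_
    · simp only [Set.ofPred_exists, gt_iff_lt, Set.ofPred_and]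
      exact isOpen_iUnion fun n => isOpen_const.inter ((hP k).preimage (continuous_orbitMean T n))
    · exact hY0.mono fun x hx => h x (hYT x hx.1 hx.2) k
  have h1 := key (fun k t => t < 1 / ((k : ℝ) + 1)) (fun k => isOpen_Iio) fun x hx k => by
    have h2 : ∃ᶠ n in atTop, (orbitMean T x n : EReal) < ((1 / ((k : ℝ) + 1) : ℝ) : EReal) := by
      refine frequently_lt_of_liminf_lt (by isBoundedDefault) ?_
      rw [hx.1]
      exact_mod_cast Nat.one_div_pos_of_nat
    obtain ⟨n, hn, hlt⟩ := frequently_atTop.1 h2 (k + 1)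
    exact ⟨n, hn, by exact_mod_cast hlt⟩
  have h2 := key (fun k t => (k : ℝ) < t) (fun k => isOpen_Ioi) fun x hx k => by
    have h2 : ∃ᶠ n in atTop, ((k : ℝ) : EReal) < (orbitMean T x n : EReal) := by
      refine frequently_lt_of_lt_limsup (by isBoundedDefault) ?_
      rw [hx.2]
      exact EReal.coe_lt_top _
    obtain ⟨n, hn, hlt⟩ := frequently_atTop.1 h2 (k + 1)
    exact ⟨n, hn, by exact_mod_cast hlt⟩
  refine ⟨_, h1.and h2, fun x hx => isAbsolutelyMeanIrregular_of_frequently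
    (fun ε hε k => ?_) fun c k => ?_⟩
  · obtain ⟨i, hi⟩ := exists_nat_one_div_lt hε
    obtain ⟨n, hn, hlt⟩ := hx.1 (max i k)
    refine ⟨n, (le_max_right _ _).trans_lt hn, hlt.trans (lt_of_le_of_lt ?_ hi)⟩
    exact Nat.one_div_le_one_div (le_max_left _ _)
  · obtain ⟨i, hi⟩ := exists_nat_gt c
    obtain ⟨n, hn, hlt⟩ := hx.2 (max i k)
    refine ⟨n, (le_max_right _ _).trans_lt hn, hi.trans_le (le_trans ?_ hlt.le)⟩
    exact_mod_cast le_max_left i k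

variable [CompleteSpace X]

/-- With `B = -r⁻¹ • A`, some power of `B * K` has norm less than `1`. Then `1 - (B * K) ^ n` is
invertible, and so is its commuting factor `1 - B * K`. -/
lemma isUnit_of_quasinilpotent {K : X →L[𝕜] X}
    (hK : ∀ k : ℕ, ∃ n ≥ 1, ‖K ^ n‖ < (1 / (k + 1 : ℝ)) ^ n) {A : X →L[𝕜] X} (hA : Commute A K)
    {r : 𝕜} (hr : r ≠ 0) : IsUnit (A * K + r • 1) := by
  set B : X →L[𝕜] X := (-r⁻¹) • A with hB
  have hBK : Commute B K := hA.smul_left _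
  obtain ⟨k, hk⟩ := exists_nat_ge ‖B‖
  obtain ⟨n, hn, hlt⟩ := hK k
  have hpow : ‖(B * K) ^ n‖ < 1 := by
    rw [hBK.mul_pow]
    refine (norm_mul_le _ _).trans_lt ?_
    have h1 : ‖B ^ n‖ ≤ ((k : ℝ) + 1) ^ n :=
      (norm_pow_le' _ hn).trans (pow_le_pow_left₀ (norm_nonneg _) (by linarith) n)
    refine (mul_le_mul_of_nonneg_right h1 (norm_nonneg _)).trans_lt ?_
    have h2 : (0 : ℝ) < ((k : ℝ) + 1) ^ n := by positivity
    refine (mul_lt_mul_of_pos_left hlt h2).trans_eq ?_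
    rw [← mul_pow, mul_one_div_cancel (by positivity), one_pow]
  have h1 : IsUnit (1 - (B * K) ^ n) := isUnit_one_sub_of_norm_lt_one hpow
  rw [← mul_neg_geom_sum] at h1
  have hc : Commute (1 - B * K) (∑ i ∈ Finset.range n, (B * K) ^ i) :=
    Commute.sum_right _ _ _ fun i _ =>
      ((Commute.one_left _).sub_left ((Commute.refl (B * K)).pow_right i))
  have h2 := (hc.isUnit_mul_iff.1 h1).1
  have e : A * K + r • 1 = Units.mk0 r hr • (1 - B * K) := by
    rw [Units.smul_mk0, smul_sub, hB, smul_mul_assoc, smul_smul, mul_neg, mul_inv_cancel₀ hr,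
      neg_smul, one_smul, sub_neg_eq_add, add_comm]
  rw [e]
  exact h2.smul _

lemma IsIrregularPair.isManifold {K : X →L[𝕜] X} {x : X} (h : IsIrregularPair K x) :
    IsAbsolutelyMeanIrregularManifold (NormedSpace.exp K) (polynomialOrbit K x) := by
  intro y hy hy0
  obtain ⟨q, rfl⟩ := mem_polynomialOrbit.1 hy
  have hq : q ≠ 0 := by
    rintro rfl
    simp at hy0
  -- Write `q = X ^ k * r` with `r(0) ≠ 0`, so that `r(K)` is a unit.
  obtain ⟨r, hqr, hr⟩ := q.exists_eq_pow_rootMultiplicity_mul_and_not_dvd hq 0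
  set k := q.rootMultiplicity 0
  rw [Polynomial.C_0, sub_zero] at hqr hr
  rw [Polynomial.X_dvd_iff] at hr
  have hU : IsUnit (Polynomial.aeval K r) := by
    have := isUnit_of_quasinilpotent h.quasinilpotent (A := Polynomial.aeval K r.divX)
      (by simpa using (Commute.all r.divX Polynomial.X).map (Polynomial.aeval K)) hr
    convert this using 1
    conv_lhs => rw [← r.divX_mul_X_add]
    simp [Algebra.algebraMap_eq_smul_one]
  obtain ⟨U, hU⟩ := hU
  have hUc : Commute (↑U⁻¹ : X →L[𝕜] X) (NormedSpace.exp K) := by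
    have := commute_aeval_exp K r
    rw [← hU] at this
    exact this.units_inv_left
  have hUy : (↑U⁻¹ : X →L[𝕜] X) (Polynomial.aeval K q x) = (K ^ k) x := by
    rw [hqr, mul_comm, map_mul, map_pow, Polynomial.aeval_X, ← hU, mul_apply_eq_comp,
      ← mul_apply_eq_comp, Units.inv_mul, one_apply_eq_self]
  refine isAbsolutelyMeanIrregular_of_frequently (fun ε hε j => ?_) fun c j => ?_
  · set A := Polynomial.aeval K q
    obtain ⟨i, hi⟩ := exists_nat_gt (max (j : ℝ) (‖A‖ / ε))
    have hij : j < i := by exact_mod_cast (le_max_left _ _).trans_lt hi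
    have hiA : ‖A‖ < i * ε := (div_lt_iff₀ hε).1 ((le_max_right _ _).trans_lt hi)
    obtain ⟨n, hn, hlt⟩ := h.low i
    refine ⟨n, hij.trans hn, (orbitMean_map_le (commute_aeval_exp K q) x n).trans_lt ?_⟩
    refine (mul_le_mul_of_nonneg_left hlt.le (norm_nonneg _)).trans_lt ?_
    rw [mul_one_div, div_lt_iff₀ (by positivity)]
    nlinarith
  · set A := (↑U⁻¹ : X →L[𝕜] X)
    obtain ⟨i, hi⟩ := exists_nat_gt (max (j : ℝ) (‖A‖ * |c|))
    have hij : j < i := by exact_mod_cast (le_max_left _ _).trans_lt hi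
    have hiA : ‖A‖ * |c| < i := (le_max_right _ _).trans_lt hi
    obtain ⟨n, hn, hlt⟩ := h.high k i
    refine ⟨n, hij.trans hn, ?_⟩
    have h1 := orbitMean_map_le hUc (Polynomial.aeval K q x) n
    rw [hUy] at h1
    have h2 := hiA.trans (hlt.trans_le h1)
    exact (le_abs_self c).trans_lt (lt_of_mul_lt_mul_left h2 (norm_nonneg _))

/-- The partial sums of the series for `exp K ^ n x` are polynomials in `K` applied to `x`. -/
lemma IsIrregularPair.dense_polynomialOrbit {K : X →L[𝕜] X} {x : X} (h : IsIrregularPair K x) :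
    Dense (polynomialOrbit K x : Set X) := by
  refine Dense.of_closure (h.hypercyclic.mono ?_)
  rintro _ ⟨n, rfl⟩
  refine mem_closure_of_tendsto (exp_pow_apply_eq_tsum K n x) (Eventually.of_forall fun s => ?_)
  refine Submodule.sum_mem _ fun k _ => Submodule.smul_mem _ _ ?_
  exact mem_polynomialOrbit.2 ⟨Polynomial.X ^ k, by simp⟩

end Generic

/-! ### Strong approximation and the Baire category argument -/

section Approximation

variable {𝕜 X : Type*} [RCLike 𝕜] [NormedAddCommGroup X] [NormedSpace 𝕜 X]

lemma isSOTDense_of_forall_finite {𝒜 : Set (X →L[𝕜] X)}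
    (h : ∀ (T : X →L[𝕜] X) (S : Set X), S.Finite → ∀ ε > 0, ∃ A ∈ 𝒜, ∀ x ∈ S, ‖A x - T x‖ < ε) :
    IsSOTDense 𝒜 := by
  intro T
  have hb := (PointwiseConvergenceCLM.hasBasis_nhds_zero_of_basis (σ := RingHom.id 𝕜) (E := X)
    (Metric.nhds_basis_ball (x := (0 : X)))).map (T + ·)
  rw [map_add_left_nhds_zero] at hb
  rw [mem_closure_iff_nhds_basis hb]
  rintro ⟨S, ε⟩ ⟨hS, hε⟩
  obtain ⟨A, hA, hAT⟩ := h T S hS ε hε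
  refine ⟨_, ⟨A, hA, rfl⟩,
    ContinuousLinearMap.toPointwiseConvergenceCLM 𝕜 (RingHom.id 𝕜) X X A - T, fun x hx => ?_, ?_⟩
  · rw [mem_ball_zero_iff]
    exact hAT x hx
  · exact add_sub_cancel _ _

/-- Perturb `A` on `E = span S` by a small injection `δ H` of `E` into fresh directions, so that `L`
recovers `δ • P y` from `A' y`. This permits a finite rank `Q` that is the identity on `E` and
annihilates the range of `A'`. Then `A' * Q` has square zero and agrees with `A + δ H` on `E`. -/
lemma exists_squareZero_approximation (hX : ¬ FiniteDimensional 𝕜 X) (A : X →L[𝕜] X) {S : Set X}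
    (hS : S.Finite) {ε : ℝ} (hε : 0 < ε) :
    ∃ N ∈ finiteRankNilpotent 𝕜 X, N ^ 2 = 0 ∧ ∀ x ∈ S, ‖N x - A x‖ < ε := by
  set E : Submodule 𝕜 X := Submodule.span 𝕜 S with hE
  have : FiniteDimensional 𝕜 E := FiniteDimensional.span_of_finite 𝕜 hS
  set G : Submodule 𝕜 X := E ⊔ E.map (A : X →ₗ[𝕜] X) with hG
  obtain ⟨π, hπ⟩ := Submodule.ClosedComplemented.of_finiteDimensional E
  obtain ⟨_, _, hsys⟩ := exists_biorthogonal_in_kernel hX (0 : X →L[𝕜] X) G fun x => G.zero_mem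
  set r := Module.finrank 𝕜 E
  let b := Module.finBasis 𝕜 E
  obtain ⟨h, ψ, -, hψG, hψh, -⟩ := hsys r
  set P : X →L[𝕜] X := E.subtypeL.comp π with hP
  set H : X →L[𝕜] X := ∑ i : Fin r,
    (((b.coord i).toContinuousLinearMap).comp π).smulRight (h i) with hH
  set L : X →L[𝕜] X := ∑ i : Fin r, (ψ i).smulRight (b i : X) with hL
  have hHapp (y : X) : H y = ∑ i : Fin r, b.repr (π y) i • h i := by simp [hH]
  have hLapp (y : X) : L y = ∑ i : Fin r, ψ i y • (b i : X) := by simp [hL]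
  have hPE (y : X) (hy : y ∈ E) : P y = y := congrArg Subtype.val (hπ ⟨y, hy⟩)
  have hPmem (y : X) : P y ∈ E := (π y).2
  have hHP (y : X) : H (P y) = H y := by
    rw [hHapp, hHapp]
    have : π (P y) = π y := hπ (π y)
    rw [this]
  have hLG (y : X) (hy : y ∈ G) : L y = 0 := by
    rw [hLapp]
    exact Finset.sum_eq_zero fun i _ => by rw [hψG _ y hy, zero_smul]
  have hLH (y : X) : L (H y) = P y := by
    have hi (i : Fin r) : ψ i (H y) = b.repr (π y) i := by
      rw [hHapp, map_sum, Finset.sum_eq_single i]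
      · rw [map_smul, hψh i i.2 i i.2, if_pos rfl, smul_eq_mul, mul_one]
      · intro j _ hj
        rw [map_smul, hψh i i.2 j j.2, if_neg (fun h => hj (Fin.ext h.symm)), smul_zero]
      · simp
    rw [hLapp]
    simp only [hi]
    have := congrArg Subtype.val (b.sum_repr (π y))
    rw [Submodule.coe_sum] at this
    exact this
  set M : ℝ := ∑ x ∈ hS.toFinset, ‖H x‖ with hM
  have hM0 : 0 ≤ M := Finset.sum_nonneg fun _ _ => norm_nonneg _
  set δ : ℝ := ε / (M + 1) with hδ
  have hδ0 : 0 < δ := by positivity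
  have hδ𝕜 : (δ : 𝕜) ≠ 0 := RCLike.ofReal_ne_zero.2 hδ0.ne'
  set A' : X →L[𝕜] X := A * P + (δ : 𝕜) • H with hA'
  have hA'app (y : X) : A' y = A (P y) + (δ : 𝕜) • H y := rfl
  have hA'P (y : X) : A' (P y) = A' y := by
    rw [hA'app, hA'app, hHP, hPE _ (hPmem y)]
  have hLA' (y : X) : L (A' y) = (δ : 𝕜) • P y := by
    rw [hA'app, map_add, map_smul, hLH, hLG, zero_add]
    exact Submodule.mem_sup_right ⟨P y, hPmem y, rfl⟩
  set Q : X →L[𝕜] X := P - (δ : 𝕜)⁻¹ • (P * A' * L) with hQ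
  have hQapp (y : X) : Q y = P y - (δ : 𝕜)⁻¹ • P (A' (L y)) := rfl
  have hQA' (y : X) : Q (A' y) = 0 := by
    rw [hQapp, hLA', map_smul, map_smul, smul_smul, inv_mul_cancel₀ hδ𝕜, one_smul, hA'P, sub_self]
  have hN2 : (A' * Q) ^ 2 = 0 := by
    ext y
    simp [pow_two, hQA']
  refine ⟨A' * Q, ⟨⟨2, hN2⟩, E.map (A' : X →ₗ[𝕜] X), inferInstance, fun y => ?_⟩, hN2,
    fun x hx => ?_⟩
  · rw [mul_apply_eq_comp, ← hA'P]
    exact ⟨P (Q y), hPmem _, rfl⟩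
  · have hxE : x ∈ E := Submodule.subset_span hx
    rw [mul_apply_eq_comp, hQapp, hLG x (Submodule.mem_sup_left hxE), map_zero, map_zero, smul_zero,
      sub_zero, hA'P, hA'app, hPE x hxE, add_sub_cancel_left, norm_smul, RCLike.norm_ofReal,
      abs_of_pos hδ0, hδ, div_mul_eq_mul_div, div_lt_iff₀ (by positivity)]
    have : ‖H x‖ ≤ M := Finset.single_le_sum (f := fun x => ‖H x‖) (fun _ _ => norm_nonneg _)
      (hS.mem_toFinset.2 hx)
    nlinarith

variable [CompleteSpace X]

lemma exp_apply_of_sq_eq_zero {N : X →L[𝕜] X} (hN : N ^ 2 = 0) (x : X) :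
    NormedSpace.exp N x = x + N x := by
  have h1 := exp_pow_apply_eq_tsum N 1 x
  rw [pow_one] at h1
  refine h1.unique ?_
  have h2 : HasSum (fun k : ℕ => ((((1 : ℕ) : ℝ) ^ k / k.factorial : ℝ) : 𝕜) • (N ^ k) x)
      (∑ k ∈ Finset.range 2, ((((1 : ℕ) : ℝ) ^ k / k.factorial : ℝ) : 𝕜) • (N ^ k) x) := by
    refine hasSum_sum_of_ne_finset_zero fun k hk => ?_
    obtain ⟨l, rfl⟩ := Nat.exists_eq_add_of_le (not_lt.1 (Finset.mem_range.not.1 hk))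
    rw [pow_add N, hN, zero_mul, zero_apply, smul_zero]
  simpa [Finset.sum_range_succ] using h2

lemma continuous_exp_clm : Continuous fun K : X →L[𝕜] X => NormedSpace.exp K := by
  let _ : NormedAlgebra ℚ (X →L[𝕜] X) := NormedAlgebra.restrictScalars ℚ 𝕜 (X →L[𝕜] X)
  exact NormedSpace.exp_continuous

variable [TopologicalSpace.SeparableSpace X]

/-- Baire's theorem in the complete space `Z`. Each condition is open because `exp` is norm
continuous, and is met near any finite rank nilpotent by the density theorems; the last one holds at
the nilpotents themselves. -/
theorem exists_isIrregularPair_near (hX : ¬ FiniteDimensional 𝕜 X) {N : X →L[𝕜] X}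
    (hN : N ∈ finiteRankNilpotent 𝕜 X) {ε : ℝ} (hε : 0 < ε) :
    ∃ (K : X →L[𝕜] X) (x : X), ‖K - N‖ < ε ∧ IsIrregularPair K x := by
  let Z := closure (finiteRankNilpotent 𝕜 X) × X
  have : CompleteSpace (closure (finiteRankNilpotent 𝕜 X)) :=
    isClosed_closure.completeSpace_coe
  have key (p : (X →L[𝕜] X) → X → Prop) (hopen : IsOpen {z : (X →L[𝕜] X) × X | p z.1 z.2})
      (hnear : ∀ N ∈ finiteRankNilpotent 𝕜 X, ∀ x : X, ∀ ε > 0, ∃ K ∈ finiteRankNilpotent 𝕜 X,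
        ∃ x' : X, ‖K - N‖ < ε ∧ ‖x' - x‖ < ε ∧ p K x') :
      ∀ᶠ z : Z in residual Z, p z.1 z.2 := by
    refine residual_of_dense_open
      (hopen.preimage ((continuous_subtype_val.comp continuous_fst).prodMk continuous_snd)) ?_
    rw [Metric.dense_iff]
    rintro ⟨⟨L, hL⟩, x⟩ ρ hρ
    obtain ⟨N, hN, hNL⟩ := Metric.mem_closure_iff.1 hL _ (half_pos hρ)
    obtain ⟨K, hK, x', hKN, hx', hp⟩ := hnear N hN x _ (half_pos hρ)
    refine ⟨(⟨K, subset_closure hK⟩, x'), ?_, hp⟩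
    rw [Metric.mem_ball, Prod.dist_eq, max_lt_iff]
    constructor
    · change dist K L < ρ
      rw [dist_comm] at hNL
      rw [← dist_eq_norm] at hKN
      linarith [dist_triangle K N L]
    · change dist x' x < ρ
      rw [dist_eq_norm]
      linarith
  have hcexp (n : ℕ) : Continuous fun z : (X →L[𝕜] X) × X => (NormedSpace.exp z.1 ^ n) z.2 :=
    ((continuous_exp_clm.comp continuous_fst).pow n).clm_apply continuous_snd
  have hcmean (k n : ℕ) : Continuous fun z : (X →L[𝕜] X) × X =>
      orbitMean (NormedSpace.exp z.1) ((z.1 ^ k) z.2) n := by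
    refine continuous_const.mul (continuous_finsetSum _ fun i _ => Continuous.norm ?_)
    exact ((continuous_exp_clm.comp continuous_fst).pow i).clm_apply
      ((continuous_fst.pow k).clm_apply continuous_snd)
  obtain ⟨B, hBc, hB0, hB⟩ := TopologicalSpace.exists_countable_basis X
  have h1 : ∀ᶠ z : Z in residual Z, ∀ V ∈ B, ∃ n : ℕ,
      (NormedSpace.exp (z.1 : X →L[𝕜] X) ^ n) z.2 ∈ V := by
    refine (eventually_countable_ball hBc).2 fun V hV =>
      key (fun K x => ∃ n : ℕ, (NormedSpace.exp K ^ n) x ∈ V) ?_ ?_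
    · simp only [Set.ofPred_exists]
      exact isOpen_iUnion fun n => (hB.isOpen hV).preimage (hcexp n)
    · intro N hN x ε hε
      obtain ⟨v, hv⟩ := Set.nonempty_iff_ne_empty.2 fun h => hB0 (h ▸ hV)
      obtain ⟨δ, hδ, hball⟩ := Metric.isOpen_iff.1 (hB.isOpen hV) v hv
      obtain ⟨K, hK, x', h1, h2, n, h3⟩ := exists_near_orbit_hitting hX hN x v (lt_min hε hδ)
      refine ⟨K, hK, x', h1.trans_le (min_le_left _ _), h2.trans_le (min_le_left _ _), n,
        hball ?_⟩
      rw [Metric.mem_ball, dist_eq_norm]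
      exact h3.trans_le (min_le_right _ _)
  have h2 : ∀ᶠ z : Z in residual Z, ∀ k : ℕ, ∃ n > k,
      orbitMean (NormedSpace.exp (z.1 : X →L[𝕜] X)) z.2 n < 1 / ((k : ℝ) + 1) := by
    refine eventually_countable_forall.2 fun k =>
      key (fun K x => ∃ n > k, orbitMean (NormedSpace.exp K) x n < 1 / ((k : ℝ) + 1)) ?_ ?_
    · simp only [Set.ofPred_exists, gt_iff_lt, Set.ofPred_and]
      exact isOpen_iUnion fun n => isOpen_const.inter (isOpen_Iio.preimage (hcmean 0 n))
    · intro N hN x ε hε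
      obtain ⟨K, hK, x', h1, h2, n, hn, h3⟩ := exists_near_orbitMean_lt hX hN x
        (lt_min hε (Nat.one_div_pos_of_nat (n := k) (α := ℝ))) k
      exact ⟨K, hK, x', h1.trans_le (min_le_left _ _), h2.trans_le (min_le_left _ _), n, hn,
        h3.trans_le (min_le_right _ _)⟩
  have h3 : ∀ᶠ z : Z in residual Z, ∀ k l : ℕ, ∃ n > l,
      (l : ℝ) < orbitMean (NormedSpace.exp (z.1 : X →L[𝕜] X)) (((z.1 : X →L[𝕜] X) ^ k) z.2) n := by
    refine eventually_countable_forall.2 fun k => eventually_countable_forall.2 fun l =>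
      key (fun K x => ∃ n > l, (l : ℝ) < orbitMean (NormedSpace.exp K) ((K ^ k) x) n) ?_ ?_
    · simp only [Set.ofPred_exists, gt_iff_lt, Set.ofPred_and]
      exact isOpen_iUnion fun n => isOpen_const.inter (isOpen_Ioi.preimage (hcmean k n))
    · intro N hN x ε hε
      exact exists_near_orbitMean_gt hX hN x hε k l l
  have h4 : ∀ᶠ z : Z in residual Z, ∀ k : ℕ, ∃ n ≥ 1,
      ‖(z.1 : X →L[𝕜] X) ^ n‖ < (1 / (k + 1 : ℝ)) ^ n := by
    refine eventually_countable_forall.2 fun k =>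
      key (fun K _ => ∃ n ≥ 1, ‖K ^ n‖ < (1 / (k + 1 : ℝ)) ^ n) ?_ ?_
    · simp only [Set.ofPred_exists, ge_iff_le, Set.ofPred_and]
      exact isOpen_iUnion fun n => isOpen_const.inter
        (isOpen_Iio.preimage (continuous_fst.pow n).norm)
    · intro N hN x ε hε
      obtain ⟨m, hm⟩ := hN.1
      refine ⟨N, hN, x, by simpa using hε, by simpa using hε, m + 1, by omega, ?_⟩
      rw [pow_succ, hm, zero_mul, norm_zero]
      positivity
  have hdense := dense_of_mem_residual (h1.and (h2.and (h3.and h4)))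
  obtain ⟨⟨⟨K, hK⟩, x⟩, hmem, hz1, hz2, hz3, hz4⟩ :=
    (Metric.dense_iff.1 hdense) (⟨N, subset_closure hN⟩, 0) ε hε
  refine ⟨K, x, ?_, ?_, hz2, hz3, hz4⟩
  · rw [Metric.mem_ball, Prod.dist_eq, max_lt_iff] at hmem
    rw [← dist_eq_norm]
    exact hmem.1
  · refine hB.dense_iff.2 fun V hV _ => ?_
    obtain ⟨n, hn⟩ := hz1 V hV
    exact ⟨_, hn, n, rfl⟩

theorem isSOTDense_of_isIrregularPair (hX : ¬ FiniteDimensional 𝕜 X) {𝒜 : Set (X →L[𝕜] X)}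
    (h : ∀ (K : X →L[𝕜] X) (x : X), IsIrregularPair K x → NormedSpace.exp K ∈ 𝒜) :
    IsSOTDense 𝒜 := by
  refine isSOTDense_of_forall_finite fun T S hS ε hε => ?_
  -- Approximating `T - 1` is right because `exp N = 1 + N` when `N ^ 2 = 0`.
  obtain ⟨N, hN, hN2, hNS⟩ := exists_squareZero_approximation hX (T - 1) hS hε
  have hev : ∀ᶠ K : X →L[𝕜] X in 𝓝 N, ∀ x ∈ S, ‖NormedSpace.exp K x - T x‖ < ε := by
    refine (eventually_all_finite hS).2 fun x hx => ?_
    have hc : Continuous fun K : X →L[𝕜] X => ‖NormedSpace.exp K x - T x‖ :=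
      ((continuous_exp_clm.clm_apply continuous_const).sub continuous_const).norm
    refine hc.continuousAt.eventually (gt_mem_nhds ?_)
    beta_reduce
    rw [exp_apply_of_sq_eq_zero hN2]
    convert! hNS x hx using 2
    simp only [sub_apply, one_apply_eq_self]
    abel
  obtain ⟨δ, hδ, hball⟩ := Metric.eventually_nhds_iff.1 hev
  obtain ⟨K, x, hKN, hK⟩ := exists_isIrregularPair_near hX hN hδ
  exact ⟨_, h K x hK, hball (by rwa [dist_eq_norm])⟩

end Approximation

end

theorem theorem1p2 {𝕜 : Type*} [RCLike 𝕜] {X : Type*} [NormedAddCommGroup X] [NormedSpace 𝕜 X]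
    [CompleteSpace X] [TopologicalSpace.SeparableSpace X]
    (hX : ¬ FiniteDimensional 𝕜 X) :
    IsSOTDense {T : X →L[𝕜] X | IsHypercyclic T ∧ HasResidualAbsolutelyMeanIrregular T} ∧
      IsSOTDense
        {T : X →L[𝕜] X | IsHypercyclic T ∧ HasDenseAbsolutelyMeanIrregularManifold T} := by
  have : Nontrivial X := by
    by_contra h
    rw [not_nontrivial_iff_subsingleton] at h
    exact hX inferInstance
  have key (K : X →L[𝕜] X) (x : X) (h : IsIrregularPair K x) :
      HasDenseAbsolutelyMeanIrregularManifold (NormedSpace.exp K) :=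
    ⟨_, h.dense_polynomialOrbit, h.isManifold⟩
  exact ⟨isSOTDense_of_isIrregularPair hX fun K x h => ⟨⟨x, h.hypercyclic⟩, (key K x h).hasResidual⟩,
    isSOTDense_of_isIrregularPair hX fun K x h => ⟨⟨x, h.hypercyclic⟩, key K x h⟩⟩
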